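/- Let $S_0=-\iota H_0$ and $S_k=-\iota H_k$ ($k=1,\dots,m$), where $H_0,\dots,H_m$ are Hermitian $n\times n$ matrices, and assume that the system $\dot X=(S_0+\sum_{k=1}^m u_kS_k)X$ is controllable on $\mathrm U(n)$: piecewise continuous controls can steer any unitary matrix to any other one in finite time. Then there are $M_0\in\mathbb N$ and a nonzero real polynomial $Q$ in the variables $u_k^{(j)}$ ($1\le k\le m$, $0\le j\le M_0$), depending only on $H_0,\dots,H_m$, whose zero set in the space $\mathbb R^{m(M_0+1)}$ of $M_0$-jets has Lebesgue measure zero, and for which the following holds. Let $\overline n<n$, let $E\in\mathbb C^{n\times\overline n}$ have orthonormal columns, and let $K>0$ and $T_f>0$. Put $\mathcal V(\widetilde X)=2\overline n-2\,\mathrm{Re}\,\mathrm{trace}(E^\dagger\widetilde XE)$ and $\mathrm{pdist}(X,Y)=\|(X-Y)E\|$ (Frobenius norm). Consider an execution of the Reference Input Generation Algorithm (RIGA) on $[0,T_f]$ with a seed input $\overline u^{0}:[0,T_f]\to\mathbb R^m$ of class $C^{M_0}$, as follows. $X^0$ is the solution of the system with input $\overline u^0$ and $X^0(0)=I$. In step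 $\ell\ge1$ a unitary goal matrix $\overline X_{goal_\ell}$ is chosen arbitrarily, the reference trajectory is $\overline X^{\ell-1}(t)=X^{\ell-1}(t)R_\ell$ with $R_\ell=X^{\ell-1}(T_f)^\dagger\overline X_{goal_\ell}$, and $X^\ell$ is the solution with $X^\ell(0)=I$ of the closed loop system whose input is $$\overline u^\ell_k(t)=\overline u^{\ell-1}_k(t)+\widetilde u_k(t),\qquad \widetilde u_k(t)=-K\,\nabla_{\widetilde X^\ell(t)}\mathcal V\cdot\big(\widetilde S_k(t)\widetilde X^\ell(t)\big)=2K\,\mathrm{Re}\,\mathrm{trace}\big(E^\dagger\widetilde S_k(t)\widetilde X^\ell(t)E\big),$$ where $\widetilde X^\ell=(\overline X^{\ell-1})^\dagger X^\ell$ and $\widetilde S_k=(\overline X^{\ell-1})^\dagger S_k\overline X^{\ell-1}$. Write $X_f^\ell=X^\ell(T_f)$. Let $\ell\ge2$ be a step that has been executed, and assume: (a) the reference inputs $\overline u_k^{\ell-1}$, $k=1,\dots,m$, do not satisfy the differential equation $Q=0$ identically on $[0,T_f]$; (b) $\mathrm{pdist}(X_f^{\ell-1},\overline X_{goal_{\ell-1}})<2$;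 (c) $(\overline X_{goal_\ell}-\overline X_{goal_{\ell-1}})E=0$. Then there exists $\lambda\in(0,1)$ such that $$\mathrm{pdist}(X_f^{\ell},\overline X_{goal_\ell})\le\sqrt\lambda\;\mathrm{pdist}(X_f^{\ell-1},\overline X_{goal_{\ell-1}})\quad\text{and}\quad \mathcal V(\widetilde X^\ell(T_f))\le\lambda\,\mathcal V(\widetilde X^{\ell-1}(T_f)).$$ -/

import Mathlib

open Set Matrix MeasureTheory

noncomputable section

/-- A closed quantum system: a drift Hamiltonian `H0` and `m` control Hamiltonians `H k`, all
Hermitian `n × n` matrices. -/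
structure QuantumSystem (n m : ℕ) where
  H0 : Matrix (Fin n) (Fin n) ℂ
  H : Fin m → Matrix (Fin n) (Fin n) ℂ
  H0_hermitian : H0.IsHermitian
  H_hermitian : ∀ k, (H k).IsHermitian

namespace QuantumSystem

variable {n m : ℕ} (sys : QuantumSystem n m)

/-- `S₀ = -ι H₀`. -/
def S0 : Matrix (Fin n) (Fin n) ℂ := (-Complex.I) • sys.H0

/-- `S_k = -ι H_k`. -/
def S (k : Fin m) : Matrix (Fin n) (Fin n) ℂ := (-Complex.I) • sys.H k

/-- The generator `S₀ + ∑ₖ vₖ S_k` for the control value `v`. -/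
def generator (v : Fin m → ℝ) : Matrix (Fin n) (Fin n) ℂ :=
  sys.S0 + ∑ k, (v k : ℂ) • sys.S k

/-- `X` solves `Ẋ(t) = (S₀ + ∑ₖ uₖ(t) S_k) X(t)` on `[0, T]` (entrywise, with one-sided derivatives
at the end points). -/
def IsSolution (T : ℝ) (u : ℝ → Fin m → ℝ) (X : ℝ → Matrix (Fin n) (Fin n) ℂ) : Prop :=
  ∀ t ∈ Icc 0 T, ∀ i j,
    HasDerivWithinAt (fun s => X s i j) ((sys.generator (u t) * X t) i j) (Icc 0 T) t

/-- Some continuous control steers `A` to `B` in some positive time. -/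
def Steers (A B : Matrix (Fin n) (Fin n) ℂ) : Prop :=
  ∃ T : ℝ, 0 < T ∧ ∃ (u : ℝ → Fin m → ℝ) (X : ℝ → Matrix (Fin n) (Fin n) ℂ),
    ContinuousOn u (Icc 0 T) ∧ sys.IsSolution T u X ∧ X 0 = A ∧ X T = B

/-- Controllability on `U(n)`: any unitary matrix can be steered to any other one in finite time.
Finite concatenations of continuous controls are allowed, that is, the admissible controls are the
piecewise continuous ones. -/
def Controllable : Prop :=
  ∀ A ∈ unitaryGroup (Fin n) ℂ, ∀ B ∈ unitaryGroup (Fin n) ℂ,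
    Relation.ReflTransGen sys.Steers A B

end QuantumSystem

variable {n nbar m : ℕ}

/-- The partial trace Lyapunov function `𝒱(X̃) = 2 n̄ - 2 Re trace (E† X̃ E)`. -/
def lyapunov (E : Matrix (Fin n) (Fin nbar) ℂ) (Xt : Matrix (Fin n) (Fin n) ℂ) : ℝ :=
  2 * (nbar : ℝ) - 2 * (trace (Eᴴ * Xt * E)).re

/-- The partial distance `pdist(X, Y) = ‖(X - Y) E‖`, in the Frobenius norm. -/
def pdist (E : Matrix (Fin n) (Fin nbar) ℂ) (X Y : Matrix (Fin n) (Fin n) ℂ) : ℝ :=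
  letI := Matrix.frobeniusNormedAddCommGroup (m := Fin n) (n := Fin nbar) (α := ℂ)
  ‖(X - Y) * E‖

/-- The Lyapunov-based tracking control `ũ = -K ∇𝒱(X̃) · (S̃ X̃)`, where `X̃ = X̄† X` and
`S̃ = X̄† S X̄`, for the control direction `S`, the reference `Xbar` and the state `X`. -/
def feedback (E : Matrix (Fin n) (Fin nbar) ℂ) (K : ℝ) (S Xbar X : Matrix (Fin n) (Fin n) ℂ) : ℝ :=
  -K * lineDeriv ℝ (lyapunov E) (Xbarᴴ * X) ((Xbarᴴ * S * Xbar) * (Xbarᴴ * X))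

/-- The explicit form `ũ = 2 K Re trace (E† S̃ X̃ E)` of the tracking control. -/
theorem feedback_eq (E : Matrix (Fin n) (Fin nbar) ℂ) (K : ℝ)
    (S Xbar X : Matrix (Fin n) (Fin n) ℂ) :
    feedback E K S Xbar X =
      2 * K * (trace (Eᴴ * ((Xbarᴴ * S * Xbar) * (Xbarᴴ * X)) * E)).re := by
  set A := Xbarᴴ * X
  set D := (Xbarᴴ * S * Xbar) * A
  have h : ∀ t : ℝ, lyapunov E (A + t • D) =
      lyapunov E A + t * (-2 * (trace (Eᴴ * D * E)).re) := by
    intro t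
    simp only [lyapunov, Matrix.mul_add, Matrix.add_mul, Matrix.trace_add, Matrix.mul_smul,
      Matrix.smul_mul, Matrix.trace_smul, Complex.add_re, Complex.real_smul, Complex.re_ofReal_mul]
    ring
  have h2 : lineDeriv ℝ (lyapunov E) A D = -2 * (trace (Eᴴ * D * E)).re := by
    unfold lineDeriv
    simp only [h]
    simp
  change -K * lineDeriv ℝ (lyapunov E) A D = _
  rw [h2]
  ring

/-- An execution of the first `N` steps of the Reference Input Generation Algorithm on `[0, Tf]`.
* `u ℓ` is the input `ū^ℓ` and `X ℓ` the propagator `X^ℓ` with that input; `u 0` is the seed;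
* `goal ℓ` is the unitary goal matrix chosen in step `ℓ`, for `1 ≤ ℓ ≤ N`;
* step `ℓ + 1` takes the reference input `ū^ℓ` and the right-translated reference trajectory
  `X̄^ℓ(t) = X^ℓ(t) R_{ℓ+1}`, where `R_{ℓ+1} = X^ℓ(Tf)† goal_{ℓ+1}`, and runs the closed loop from
  the identity; the closed loop input is `ū^{ℓ+1}`.
Values of `u ℓ` and `X ℓ` outside `[0, Tf]` play no role. -/
structure RIGA (sys : QuantumSystem n m) (E : Matrix (Fin n) (Fin nbar) ℂ) (K Tf : ℝ) (N : ℕ) where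
  u : ℕ → ℝ → Fin m → ℝ
  X : ℕ → ℝ → Matrix (Fin n) (Fin n) ℂ
  goal : ℕ → Matrix (Fin n) (Fin n) ℂ
  seed_continuous : ContinuousOn (u 0) (Icc 0 Tf)
  goal_unitary : ∀ ℓ, 1 ≤ ℓ → ℓ ≤ N → goal ℓ ∈ unitaryGroup (Fin n) ℂ
  initial : ∀ ℓ ≤ N, X ℓ 0 = 1
  solution : ∀ ℓ ≤ N, sys.IsSolution Tf (u ℓ) (X ℓ)
  closed_loop : ∀ ℓ < N, ∀ t ∈ Icc 0 Tf, ∀ k,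
    u (ℓ + 1) t k =
      u ℓ t k + feedback E K (sys.S k) (X ℓ t * ((X ℓ Tf)ᴴ * goal (ℓ + 1))) (X (ℓ + 1) t)

namespace RIGA

variable {sys : QuantumSystem n m} {E : Matrix (Fin n) (Fin nbar) ℂ} {K Tf : ℝ} {N : ℕ}

/-- The reference trajectory `X̄^ℓ(t) = X^ℓ(t) R_{ℓ+1}`, which is the one tracked in step `ℓ + 1`. -/
def reference (r : RIGA sys E K Tf N) (ℓ : ℕ) (t : ℝ) : Matrix (Fin n) (Fin n) ℂ :=
  r.X ℓ t * ((r.X ℓ Tf)ᴴ * r.goal (ℓ + 1))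

/-- The tracking error `X̃^ℓ(t) = X̄^{ℓ-1}(t)† X^ℓ(t)` of step `ℓ ≥ 1`. -/
def error (r : RIGA sys E K Tf N) (ℓ : ℕ) (t : ℝ) : Matrix (Fin n) (Fin n) ℂ :=
  (r.reference (ℓ - 1) t)ᴴ * r.X ℓ t

end RIGA

/-- The value at time `t` of the differential polynomial `Q` (in the variables `uₖ^{(j)}`,
`j ≤ M₀`) along the inputs `u` on `[0, Tf]`. -/
def evalDiffPoly {M₀ : ℕ} (Q : MvPolynomial (Fin m × Fin (M₀ + 1)) ℝ) (Tf : ℝ)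
    (u : ℝ → Fin m → ℝ) (t : ℝ) : ℝ :=
  MvPolynomial.eval
    (fun p => iteratedDerivWithin (p.2 : ℕ) (fun s => u s p.1) (Icc 0 Tf) t) Q

end

open Set Matrix MeasureTheory

noncomputable section

/-! Along the closed loop the Lyapunov function `𝒱` of the tracking error has derivative `-∑ ũₖ² /
K`, so it never increases. By (c) each step starts at the value where the previous one ended, and
`pdist² = 𝒱` (`pdist_sq`), so it suffices to exclude that a positive `𝒱 < 4` stays constant during a
step.

If it does, all `ũₖ` vanish, the closed loop repeats the old trajectory `X`, and `X† S_k X` is trace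
orthogonal at all times to `P - P†`, where `P = E E† R†` (`trace_eq_zero_of_lyapunov_le`).
Differentiating in time gives the same for the brackets `B_k^j` evaluated at the jets of the input.
At a time where `Q ≠ 0` this forces `P - P†` to be scalar (`exists_diffPoly`). Such an `R†` is a
critical point at which `𝒱` is a multiple of `4` (`lyapunov_eq_zero_of_critical`), so `𝒱 = 0`, a
contradiction.

The polynomial `Q` comes from algebra over the ring of differential polynomials. The saturated span
`W` of the `B_k^j` is stable under `D = d/dt + [·, G]`. As it is generated up to torsion by finitely
many brackets, it is stable under `∂/∂uₖ^(r)` for large `r`, and the relations `[∂/∂uₖ^(r+1), D] =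
∂/∂uₖ^(r)` and `[∂/∂uₖ, D] = [·, S_k]` carry this down to stability under brackets with every `S_k`.
The constant matrices in `W` are then invariant under conjugation along trajectories, hence by
controllability under all of `U(n)`, and only scalar Hermitian matrices are orthogonal to them. `Q`
is obtained from a common denominator. -/

/-! ### Saturated submodules over a domain -/

/-- The elements of a module over a domain that have a nonzero multiple in `W`. -/
def Submodule.torsionSaturation {R M : Type*} [CommRing R] [IsDomain R] [AddCommGroup M]
    [Module R M] (W : Submodule R M) : Submodule R M where
  carrier := {w | ∃ a : R, a ≠ 0 ∧ a • w ∈ W}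
  zero_mem' := ⟨1, one_ne_zero, by simp⟩
  add_mem' := by
    rintro v w ⟨a, ha, hv⟩ ⟨b, hb, hw⟩
    refine ⟨a * b, mul_ne_zero ha hb, ?_⟩
    rw [smul_add]
    refine W.add_mem ?_ ?_
    · rw [mul_comm, mul_smul]
      exact W.smul_mem b hv
    · rw [mul_smul]
      exact W.smul_mem a hw
  smul_mem' := by
    rintro c w ⟨a, ha, hw⟩
    exact ⟨a, ha, by rw [smul_comm]; exact W.smul_mem c hw⟩

section Saturation

variable {R M : Type*} [CommRing R] [IsDomain R] [AddCommGroup M] [Module R M]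

theorem Submodule.le_torsionSaturation (W : Submodule R M) : W ≤ W.torsionSaturation :=
  fun w hw => ⟨1, one_ne_zero, by simpa using hw⟩

theorem Submodule.mem_torsionSaturation_of_smul_mem {W : Submodule R M} {a : R} (ha : a ≠ 0)
    {w : M} (h : a • w ∈ W.torsionSaturation) : w ∈ W.torsionSaturation := by
  obtain ⟨b, hb, hw⟩ := h
  exact ⟨b * a, mul_ne_zero hb ha, by rwa [mul_smul]⟩

/-- A map that obeys the Leibniz rule and sends the generators into the saturation preserves the
saturation. -/
theorem Submodule.torsionSaturation_stable {s : Set M} {δ : M →+ M} {d : R → R}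
    (hδ : ∀ (a : R) (w : M), δ (a • w) = d a • w + a • δ w)
    (hs : ∀ w ∈ s, δ w ∈ (Submodule.span R s).torsionSaturation) {w : M}
    (hw : w ∈ (Submodule.span R s).torsionSaturation) :
    δ w ∈ (Submodule.span R s).torsionSaturation := by
  have key : ∀ v ∈ Submodule.span R s, δ v ∈ (Submodule.span R s).torsionSaturation := by
    intro v hv
    induction hv using Submodule.span_induction with
    | mem x hx => exact hs x hx
    | zero => simp
    | add x y _ _ hx hy => rw [map_add]; exact Submodule.add_mem _ hx hy
    | smul a x hx h =>
      rw [hδ]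
      exact Submodule.add_mem _ (Submodule.smul_mem _ _ (Submodule.le_torsionSaturation _ hx))
        (Submodule.smul_mem _ _ h)
  -- By Leibniz, `a • δ w` is the difference of `δ (a • w)` and `d a • w`, which both lie in the
  -- saturation; then `a` is cancelled.
  obtain ⟨a, ha, hv⟩ := hw
  have h1 := key _ hv
  rw [hδ] at h1
  refine Submodule.mem_torsionSaturation_of_smul_mem ha ?_
  have h2 : d a • w ∈ (Submodule.span R s).torsionSaturation := Submodule.smul_mem _ _ ⟨a, ha, hv⟩
  simpa using Submodule.sub_mem _ h1 h2

end Saturation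

/-! ### Iterated brackets along the jets of the inputs -/

open MvPolynomial in
/-- The total derivative on differential polynomials, which shifts the order of the jets. -/
def jetShift (m : ℕ) : Derivation ℂ (MvPolynomial (Fin m × ℕ) ℂ) (MvPolynomial (Fin m × ℕ) ℂ) :=
  mkDerivation ℂ fun p => X (p.1, p.2 + 1)

namespace Derivation

variable {n : ℕ} {A : Type*} [CommRing A] [Algebra ℂ A]

/-- A derivation applied to the entries of a matrix. -/
def matrixMap (n : ℕ) (d : Derivation ℂ A A) :
    Matrix (Fin n) (Fin n) A →+ Matrix (Fin n) (Fin n) A :=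
  (d : A →+ A).mapMatrix

@[simp] theorem matrixMap_apply (d : Derivation ℂ A A) (M : Matrix (Fin n) (Fin n) A)
    (i j : Fin n) : d.matrixMap n M i j = d (M i j) := rfl

theorem matrixMap_smul (d : Derivation ℂ A A) (a : A) (M : Matrix (Fin n) (Fin n) A) :
    d.matrixMap n (a • M) = d a • M + a • d.matrixMap n M := by
  ext i j
  simp [add_comm, mul_comm]

theorem matrixMap_mul (d : Derivation ℂ A A) (M N : Matrix (Fin n) (Fin n) A) :
    d.matrixMap n (M * N) = d.matrixMap n M * N + M * d.matrixMap n N := by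
  ext i j
  simp [Matrix.mul_apply, Finset.sum_add_distrib, add_comm, mul_comm]

theorem matrixMap_algebraMap (d : Derivation ℂ A A) (x : Matrix (Fin n) (Fin n) ℂ) :
    d.matrixMap n (x.map (algebraMap ℂ A)) = 0 := by
  ext i j
  simp

end Derivation

namespace QuantumSystem

open MvPolynomial

variable {n m : ℕ} (sys : QuantumSystem n m)

/-- The generator with indeterminate control values. -/
def jetGenerator : Matrix (Fin n) (Fin n) (MvPolynomial (Fin m × ℕ) ℂ) :=
  sys.S0.map (algebraMap ℂ _) + ∑ k, (X (k, 0) : MvPolynomial (Fin m × ℕ) ℂ) •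
    (sys.S k).map (algebraMap ℂ _)

/-- The operator `w ↦ w' + [w, G]`, with `G` the generator, on matrices of differential
polynomials. -/
def jetBracket : Matrix (Fin n) (Fin n) (MvPolynomial (Fin m × ℕ) ℂ) →+
    Matrix (Fin n) (Fin n) (MvPolynomial (Fin m × ℕ) ℂ) :=
  (jetShift m).matrixMap n + (AddMonoidHom.mulRight sys.jetGenerator -
    AddMonoidHom.mulLeft sys.jetGenerator)

theorem jetBracket_apply (w : Matrix (Fin n) (Fin n) (MvPolynomial (Fin m × ℕ) ℂ)) :
    sys.jetBracket w = (jetShift m).matrixMap n w +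
      (w * sys.jetGenerator - sys.jetGenerator * w) := rfl

theorem jetBracket_smul (a : MvPolynomial (Fin m × ℕ) ℂ)
    (w : Matrix (Fin n) (Fin n) (MvPolynomial (Fin m × ℕ) ℂ)) :
    sys.jetBracket (a • w) = jetShift m a • w + a • sys.jetBracket w := by
  simp only [jetBracket_apply, Derivation.matrixMap_smul, Matrix.smul_mul, Matrix.mul_smul,
    smul_add, smul_sub, add_assoc]

/-- The brackets `B_k^j` of the linearized system: `B_k^0 = S_k` and
`B_k^{j+1} = (B_k^j)' + [B_k^j, G]`. -/
def controlBracket (k : Fin m) : ℕ → Matrix (Fin n) (Fin n) (MvPolynomial (Fin m × ℕ) ℂ)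
  | 0 => (sys.S k).map (algebraMap ℂ _)
  | j + 1 => sys.jetBracket (controlBracket k j)

theorem pderiv_jetGenerator_succ (k : Fin m) (r : ℕ) :
    (pderiv (k, r + 1)).matrixMap n sys.jetGenerator = 0 := by
  simp only [jetGenerator, map_add, map_sum, Derivation.matrixMap_smul,
    Derivation.matrixMap_algebraMap]
  simp [pderiv_X]

theorem pderiv_jetGenerator_zero (k : Fin m) :
    (pderiv (k, 0)).matrixMap n sys.jetGenerator = (sys.S k).map (algebraMap ℂ _) := by
  simp only [jetGenerator, map_add, map_sum, Derivation.matrixMap_smul,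
    Derivation.matrixMap_algebraMap]
  simp [pderiv_X, Pi.single_apply, eq_comm]

/-- Both sides are derivations in `p`, so it is enough to compare them on the variables. -/
theorem pderiv_jetShift_succ (k : Fin m) (r : ℕ) (p : MvPolynomial (Fin m × ℕ) ℂ) :
    pderiv (k, r + 1) (jetShift m p) - jetShift m (pderiv (k, r + 1) p) = pderiv (k, r) p := by
  have : ⁅(pderiv (k, r + 1) : Derivation ℂ (MvPolynomial (Fin m × ℕ) ℂ) _), jetShift m⁆ =
      pderiv (k, r) := by
    refine MvPolynomial.derivation_ext fun i => ?_
    simp only [Derivation.commutator_apply, jetShift, mkDerivation_X, pderiv_X, Pi.single_apply]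
    obtain ⟨a, b⟩ := i
    simp only [Prod.mk.injEq, add_left_inj]
    split_ifs <;> simp
  rw [← this, Derivation.commutator_apply]

theorem pderiv_jetShift_zero (k : Fin m) (p : MvPolynomial (Fin m × ℕ) ℂ) :
    pderiv (k, 0) (jetShift m p) - jetShift m (pderiv (k, 0) p) = 0 := by
  have : ⁅(pderiv (k, 0) : Derivation ℂ (MvPolynomial (Fin m × ℕ) ℂ) _), jetShift m⁆ = 0 := by
    refine MvPolynomial.derivation_ext fun i => ?_
    simp only [Derivation.commutator_apply, jetShift, mkDerivation_X, pderiv_X, Pi.single_apply]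
    obtain ⟨a, b⟩ := i
    simp only [Prod.mk.injEq, Nat.succ_ne_zero, and_false, if_false]
    split_ifs <;> simp
  rw [← Derivation.commutator_apply, this, Derivation.zero_apply]

/-- The generator involves no jets of positive order, so only the total derivative contributes. This
relation lowers the order of a partial derivative by one. -/
theorem pderiv_jetBracket_succ (k : Fin m) (r : ℕ)
    (w : Matrix (Fin n) (Fin n) (MvPolynomial (Fin m × ℕ) ℂ)) :
    (pderiv (k, r + 1)).matrixMap n (sys.jetBracket w) -
      sys.jetBracket ((pderiv (k, r + 1)).matrixMap n w) = (pderiv (k, r)).matrixMap n w := by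
  have h : (pderiv (k, r + 1)).matrixMap n ((jetShift m).matrixMap n w) -
      (jetShift m).matrixMap n ((pderiv (k, r + 1)).matrixMap n w) =
      (pderiv (k, r)).matrixMap n w := by
    ext1 i j
    exact pderiv_jetShift_succ k r (w i j)
  simp only [jetBracket_apply, map_add, map_sub, Derivation.matrixMap_mul,
    pderiv_jetGenerator_succ, mul_zero, zero_mul, add_zero, zero_add]
  rw [← h]
  abel

/-- Here the generator contributes its coefficient of `uₖ`, which is how a single control direction
is isolated. -/
theorem pderiv_jetBracket_zero (k : Fin m)
    (w : Matrix (Fin n) (Fin n) (MvPolynomial (Fin m × ℕ) ℂ)) :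
    (pderiv (k, 0)).matrixMap n (sys.jetBracket w) -
      sys.jetBracket ((pderiv (k, 0)).matrixMap n w) =
      w * (sys.S k).map (algebraMap ℂ _) - (sys.S k).map (algebraMap ℂ _) * w := by
  have h : (pderiv (k, 0)).matrixMap n ((jetShift m).matrixMap n w) -
      (jetShift m).matrixMap n ((pderiv (k, 0)).matrixMap n w) = 0 := by
    ext1 i j
    exact pderiv_jetShift_zero k (w i j)
  simp only [jetBracket_apply, map_add, map_sub, Derivation.matrixMap_mul,
    pderiv_jetGenerator_zero]
  rw [sub_eq_zero.mp h]
  abel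

/-- Finitely many brackets generate all of them up to torsion. -/
theorem exists_finite_controlBracket_mem : ∃ s : Set (Fin m × ℕ), s.Finite ∧
    ∀ p : Fin m × ℕ, sys.controlBracket p.1 p.2 ∈ (Submodule.span (MvPolynomial (Fin m × ℕ) ℂ)
      ((fun p : Fin m × ℕ => sys.controlBracket p.1 p.2) '' s)).torsionSaturation := by
  -- An independent family is finite because the matrices form a free module of finite rank; by
  -- maximality every other bracket has a nonzero multiple in the span.
  obtain ⟨s, hs, hmax⟩ := exists_maximal_linearIndepOn (MvPolynomial (Fin m × ℕ) ℂ)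
    (fun p : Fin m × ℕ => sys.controlBracket p.1 p.2)
  refine ⟨s, have : Finite s := LinearIndependent.finite hs; s.toFinite, fun p => ?_⟩
  by_cases hp : p ∈ s
  · exact Submodule.le_torsionSaturation _ (Submodule.subset_span ⟨p, hp, rfl⟩)
  · exact hmax p hp

/-- The constant matrices in a submodule of matrices of differential polynomials. -/
def constants (W : Submodule (MvPolynomial (Fin m × ℕ) ℂ)
    (Matrix (Fin n) (Fin n) (MvPolynomial (Fin m × ℕ) ℂ))) :
    Submodule ℂ (Matrix (Fin n) (Fin n) ℂ) :=
  (W.restrictScalars ℂ).comap (Algebra.linearMap ℂ (MvPolynomial (Fin m × ℕ) ℂ)).mapMatrix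

theorem mem_constants {W : Submodule (MvPolynomial (Fin m × ℕ) ℂ)
    (Matrix (Fin n) (Fin n) (MvPolynomial (Fin m × ℕ) ℂ))} {x : Matrix (Fin n) (Fin n) ℂ} :
    x ∈ constants W ↔ x.map (algebraMap ℂ _) ∈ W := Iff.rfl

/-- Along generic jets, the brackets span a subspace of matrices that contains the control
directions and is closed under the brackets with the drift and with the control directions. -/
theorem exists_generic_subspace : ∃ (s : Set (Fin m × ℕ))
    (J : Submodule ℂ (Matrix (Fin n) (Fin n) ℂ)),
    s.Finite ∧ (∀ k, sys.S k ∈ J) ∧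
    (∀ x ∈ J, x * sys.S0 - sys.S0 * x ∈ J) ∧ (∀ k, ∀ x ∈ J, x * sys.S k - sys.S k * x ∈ J) ∧
    ∀ x ∈ J, ∃ q : MvPolynomial (Fin m × ℕ) ℂ, q ≠ 0 ∧ q • x.map (algebraMap ℂ _) ∈
      Submodule.span (MvPolynomial (Fin m × ℕ) ℂ)
        ((fun p : Fin m × ℕ => sys.controlBracket p.1 p.2) '' s) := by
  obtain ⟨s, hs, hmem⟩ := sys.exists_finite_controlBracket_mem
  set W := (Submodule.span (MvPolynomial (Fin m × ℕ) ℂ)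
      ((fun p : Fin m × ℕ => sys.controlBracket p.1 p.2) '' s)).torsionSaturation with hW
  have hD : ∀ w ∈ W, sys.jetBracket w ∈ W := by
    intro w hw
    refine Submodule.torsionSaturation_stable sys.jetBracket_smul ?_ hw
    rintro _ ⟨p, -, rfl⟩
    exact hmem (p.1, p.2 + 1)
  -- The finitely many generators involve finitely many variables, so derivatives in jets of high
  -- order annihilate them.
  have hbig : ∃ N, ∀ r ≥ N, ∀ k, ∀ w ∈ W, (pderiv (k, r)).matrixMap n w ∈ W := by
    set V := ⋃ p ∈ s, ⋃ (i : Fin n) (j : Fin n),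
      Prod.snd '' ((sys.controlBracket p.1 p.2 i j).vars : Set (Fin m × ℕ)) with hV
    have hVf : V.Finite := hs.biUnion fun p _ => Set.finite_iUnion fun i => Set.finite_iUnion
      fun j => (Finset.finite_toSet _).image _
    obtain ⟨N, hN⟩ := hVf.bddAbove
    refine ⟨N + 1, fun r hr k w hw => ?_⟩
    refine Submodule.torsionSaturation_stable (Derivation.matrixMap_smul _) ?_ hw
    rintro _ ⟨p, hp, rfl⟩
    have : (pderiv (k, r)).matrixMap n (sys.controlBracket p.1 p.2) = 0 := by
      ext1 i j
      refine pderiv_eq_zero_of_notMem_vars fun hmem => ?_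
      have h1 : r ∈ V := by
        simp only [hV, Set.mem_iUnion]
        exact ⟨p, hp, i, j, (k, r), hmem, rfl⟩
      have := hN h1
      omega
    simp only [this, Submodule.zero_mem]
  -- Descending induction on `r`, through the commutator relation.
  have hall : ∀ r k, ∀ w ∈ W, (pderiv (k, r)).matrixMap n w ∈ W := by
    obtain ⟨N, hN⟩ := hbig
    intro r
    induction hd : N - r generalizing r with
    | zero => exact hN r (by omega)
    | succ d ih =>
      intro k w hw
      rw [← sys.pderiv_jetBracket_succ k r w]
      exact W.sub_mem (ih (r + 1) (by omega) k _ (hD w hw)) (hD _ (ih (r + 1) (by omega) k w hw))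
  have hS : ∀ k, ∀ w ∈ W, w * (sys.S k).map (algebraMap ℂ _) -
      (sys.S k).map (algebraMap ℂ _) * w ∈ W := by
    intro k w hw
    rw [← sys.pderiv_jetBracket_zero k w]
    exact W.sub_mem (hall 0 k _ (hD w hw)) (hD _ (hall 0 k w hw))
  refine ⟨s, constants W, hs, fun k => hmem (k, 0), ?_, ?_, fun x hx => hx⟩
  · intro x hx
    rw [mem_constants] at hx ⊢
    have h1 := hD _ hx
    -- For constant `x`, `jetBracket x = [x, S₀] + ∑ uₖ [x, S_k]`; removing the control part leaves
    -- the drift bracket.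
    have h2 : ∑ k, (X (k, 0) : MvPolynomial (Fin m × ℕ) ℂ) •
        (x.map (algebraMap ℂ _) * (sys.S k).map (algebraMap ℂ _) -
      (sys.S k).map (algebraMap ℂ _) * x.map (algebraMap ℂ _)) ∈ W :=
      Submodule.sum_mem _ fun k _ => W.smul_mem _ (hS k _ hx)
    convert W.sub_mem h1 h2 using 1
    rw [jetBracket_apply, Derivation.matrixMap_algebraMap, jetGenerator]
    simp only [Matrix.mul_add, Matrix.add_mul, Matrix.mul_sum, Matrix.sum_mul, Matrix.mul_smul,
      Matrix.smul_mul, smul_sub, Finset.sum_sub_distrib, Matrix.map_mul, Matrix.map_sub,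
      map_sub, forall_const]
    abel
  · intro k x hx
    rw [mem_constants] at hx ⊢
    have h1 := hS k _ hx
    simpa only [Matrix.map_mul, Matrix.map_sub, map_sub, forall_const, implies_true] using h1

end QuantumSystem

/-! ### Entrywise derivatives of matrix valued functions -/

/-- Entrywise differentiability of a matrix valued function at a point, within a set. -/
def HasMatrixDerivWithinAt {a b : ℕ} (A : ℝ → Matrix (Fin a) (Fin b) ℂ)
    (A' : Matrix (Fin a) (Fin b) ℂ) (s : Set ℝ) (t : ℝ) : Prop :=
  ∀ i j, HasDerivWithinAt (fun r => A r i j) (A' i j) s t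

namespace HasMatrixDerivWithinAt

variable {a b c : ℕ} {s : Set ℝ} {t : ℝ}

theorem const (A : Matrix (Fin a) (Fin b) ℂ) :
    HasMatrixDerivWithinAt (fun _ => A) 0 s t :=
  fun _ _ => hasDerivWithinAt_const _ _ _

theorem mul {A : ℝ → Matrix (Fin a) (Fin b) ℂ} {B : ℝ → Matrix (Fin b) (Fin c) ℂ} {A' B'}
    (hA : HasMatrixDerivWithinAt A A' s t) (hB : HasMatrixDerivWithinAt B B' s t) :
    HasMatrixDerivWithinAt (fun r => A r * B r) (A' * B t + A t * B') s t := by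
  intro i j
  simp only [Matrix.mul_apply, Matrix.add_apply, ← Finset.sum_add_distrib]
  exact HasDerivWithinAt.fun_sum fun k _ => (hA i k).mul (hB k j)

theorem conjTranspose {A : ℝ → Matrix (Fin a) (Fin b) ℂ} {A'}
    (hA : HasMatrixDerivWithinAt A A' s t) :
    HasMatrixDerivWithinAt (fun r => (A r)ᴴ) A'ᴴ s t := fun i j => by
  simpa only [Matrix.conjTranspose_apply] using (hA j i).star

theorem trace {A : ℝ → Matrix (Fin a) (Fin a) ℂ} {A'}
    (hA : HasMatrixDerivWithinAt A A' s t) :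
    HasDerivWithinAt (fun r => Matrix.trace (A r)) (Matrix.trace A') s t := by
  simp only [Matrix.trace, Matrix.diag_apply]
  exact HasDerivWithinAt.fun_sum fun k _ => hA k k

theorem hasDerivWithinAt {A : ℝ → Matrix (Fin a) (Fin b) ℂ} {A'}
    (hA : HasMatrixDerivWithinAt A A' s t) :
    HasDerivWithinAt (F := Fin a → Fin b → ℂ) (fun r => A r) A' s t :=
  hasDerivWithinAt_pi.mpr fun i => hasDerivWithinAt_pi.mpr fun j => hA i j

theorem const_mul {A : ℝ → Matrix (Fin b) (Fin c) ℂ} {A'} (B : Matrix (Fin a) (Fin b) ℂ)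
    (hA : HasMatrixDerivWithinAt A A' s t) :
    HasMatrixDerivWithinAt (fun r => B * A r) (B * A') s t := by
  simpa using (const B).mul hA

theorem mul_const {A : ℝ → Matrix (Fin a) (Fin b) ℂ} {A'} (hA : HasMatrixDerivWithinAt A A' s t)
    (B : Matrix (Fin b) (Fin c) ℂ) :
    HasMatrixDerivWithinAt (fun r => A r * B) (A' * B) s t := by
  simpa using hA.mul (const B)

end HasMatrixDerivWithinAt

/-- A matrix valued function on `[0, T]` with zero derivative is constant. -/
theorem matrix_eq_of_hasMatrixDerivWithinAt_zero {a b : ℕ} {A : ℝ → Matrix (Fin a) (Fin b) ℂ}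
    {T : ℝ} (h : ∀ t ∈ Icc 0 T, HasMatrixDerivWithinAt A 0 (Icc 0 T) t) :
    ∀ t ∈ Icc 0 T, A t = A 0 := by
  intro t ht
  ext i j
  have h1 := (convex_Icc (0 : ℝ) T).norm_image_sub_le_of_norm_hasDerivWithin_le (C := 0)
    (f := fun r => A r i j) (f' := fun _ => 0) (fun x hx => h x hx i j) (by simp)
    (left_mem_Icc.mpr (ht.1.trans ht.2)) ht
  simpa [sub_eq_zero] using h1

/-- A solution of a linear differential equation with continuous coefficients that vanishes
initially is zero. -/
theorem eq_zero_of_hasDerivWithinAt_linear {F : Type*} [NormedAddCommGroup F] [NormedSpace ℝ F]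
    [FiniteDimensional ℝ F] {m : ℕ} {T : ℝ} (L₀ : F →ₗ[ℝ] F) (L : Fin m → F →ₗ[ℝ] F)
    {u : ℝ → Fin m → ℝ} (hu : ContinuousOn u (Icc 0 T)) {z : ℝ → F}
    (hz : ∀ t ∈ Icc 0 T, HasDerivWithinAt z (L₀ (z t) + ∑ k, u t k • L k (z t)) (Icc 0 T) t)
    (h0 : z 0 = 0) : ∀ t ∈ Icc 0 T, z t = 0 := by
  obtain ⟨C, hC⟩ := isCompact_Icc.exists_bound_of_continuousOn hu
  set L₀' := LinearMap.toContinuousLinearMap L₀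
  set L' := fun k => LinearMap.toContinuousLinearMap (L k)
  refine eq_zero_of_abs_deriv_le_mul_abs_self_of_eq_zero_right
    (f' := fun t => L₀ (z t) + ∑ k, u t k • L k (z t)) (K := ‖L₀'‖ + ∑ k, C * ‖L' k‖)
    (fun t ht => (hz t ht).continuousWithinAt)
    (fun t ht => (hz t (Ico_subset_Icc_self ht)).mono_of_mem_nhdsWithin
      (Icc_mem_nhdsGE_of_mem ht)) h0 ?_
  intro t ht
  refine (norm_add_le _ _).trans ?_
  rw [add_mul, Finset.sum_mul]
  refine add_le_add (L₀'.le_opNorm (z t)) ((norm_sum_le _ _).trans (Finset.sum_le_sum fun k _ => ?_))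
  rw [norm_smul, mul_assoc]
  have h1 : ‖u t k‖ ≤ C := (norm_le_pi_norm _ k).trans (hC t (Ico_subset_Icc_self ht))
  exact mul_le_mul h1 ((L' k).le_opNorm (z t)) (norm_nonneg _) ((norm_nonneg _).trans h1)

/-! ### Subspaces invariant under conjugation along trajectories -/

namespace QuantumSystem

variable {n m : ℕ} (sys : QuantumSystem n m)

theorem conjTranspose_S0 : sys.S0ᴴ = -sys.S0 := by
  simp [S0, sys.H0_hermitian.eq]

theorem conjTranspose_S (k : Fin m) : (sys.S k)ᴴ = -sys.S k := by
  simp [S, (sys.H_hermitian k).eq]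

theorem conjTranspose_generator (v : Fin m → ℝ) : (sys.generator v)ᴴ = -sys.generator v := by
  simp [generator, conjTranspose_S0, conjTranspose_S, Matrix.conjTranspose_sum,
    Finset.sum_neg_distrib, add_comm]

variable {sys}

theorem IsSolution.hasMatrixDerivWithinAt {T : ℝ} {u : ℝ → Fin m → ℝ}
    {X : ℝ → Matrix (Fin n) (Fin n) ℂ} (h : sys.IsSolution T u X) {t : ℝ} (ht : t ∈ Icc 0 T) :
    HasMatrixDerivWithinAt X (sys.generator (u t) * X t) (Icc 0 T) t := h t ht

theorem IsSolution.hasMatrixDerivWithinAt_conjTranspose {T : ℝ} {u : ℝ → Fin m → ℝ}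
    {X : ℝ → Matrix (Fin n) (Fin n) ℂ} (h : sys.IsSolution T u X) {t : ℝ} (ht : t ∈ Icc 0 T) :
    HasMatrixDerivWithinAt (fun r => (X r)ᴴ) (-((X t)ᴴ * sys.generator (u t))) (Icc 0 T) t := by
  simpa [conjTranspose_generator] using (h.hasMatrixDerivWithinAt ht).conjTranspose

/-- A subspace of matrices that is closed under the brackets with the drift and the control
directions is preserved by conjugation along trajectories. -/
theorem Steers.conj_mem {J : Submodule ℂ (Matrix (Fin n) (Fin n) ℂ)}
    (h0 : ∀ x ∈ J, x * sys.S0 - sys.S0 * x ∈ J)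
    (hk : ∀ k, ∀ x ∈ J, x * sys.S k - sys.S k * x ∈ J) {A B : Matrix (Fin n) (Fin n) ℂ}
    (h : sys.Steers A B) {x : Matrix (Fin n) (Fin n) ℂ} (hx : A * x * Aᴴ ∈ J) :
    B * x * Bᴴ ∈ J := by
  obtain ⟨T, hT, u, X, hu, hX, rfl, rfl⟩ := h
  -- `φ` is a projection with kernel `J`. Since `J` is stable under the brackets, `φ ∘ ad S` factors
  -- through `φ`, so `φ (X x X†)` solves a linear equation with zero initial value.
  obtain ⟨g, hg⟩ := LinearMap.exists_leftInverse_of_injective J.subtype (by simp)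
  set φ : Matrix (Fin n) (Fin n) ℂ →ₗ[ℂ] Matrix (Fin n) (Fin n) ℂ :=
    LinearMap.id - J.subtype ∘ₗ g with hφ
  have hφJ : ∀ y ∈ J, φ y = 0 := by
    intro y hy
    have := congrArg Subtype.val (LinearMap.congr_fun hg ⟨y, hy⟩)
    simp only [LinearMap.comp_apply, Submodule.subtype_apply, LinearMap.id_apply] at this
    simp [hφ, this]
  have hsub : ∀ y, y - φ y ∈ J := fun y => by simp [hφ]
  let ad : Matrix (Fin n) (Fin n) ℂ → Matrix (Fin n) (Fin n) ℂ →ₗ[ℂ] Matrix (Fin n) (Fin n) ℂ :=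
    fun S => LinearMap.mulLeft ℂ S - LinearMap.mulRight ℂ S
  have had : ∀ S y, ad S y = S * y - y * S := fun _ _ => rfl
  have hφad : ∀ S, (∀ y ∈ J, y * S - S * y ∈ J) → ∀ y, φ (ad S y) = φ (ad S (φ y)) := by
    intro S hS y
    have h1 := hφJ _ (J.neg_mem (hS _ (hsub y)))
    rw [neg_sub, ← had, map_sub, map_sub, sub_eq_zero] at h1
    exact h1
  let y : ℝ → Matrix (Fin n) (Fin n) ℂ := fun t => X t * x * (X t)ᴴ
  have hy : ∀ t ∈ Icc 0 T, HasMatrixDerivWithinAt y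
      (ad sys.S0 (y t) + ∑ k, (u t k : ℂ) • ad (sys.S k) (y t)) (Icc 0 T) t := by
    intro t ht
    convert ((hX.hasMatrixDerivWithinAt ht).mul_const x).mul
      (hX.hasMatrixDerivWithinAt_conjTranspose ht) using 1
    simp only [had, y, generator, Matrix.mul_add, Matrix.add_mul, Matrix.mul_sum, Matrix.sum_mul,
      Matrix.mul_smul, Matrix.smul_mul, smul_sub, Finset.sum_sub_distrib, Matrix.mul_assoc,
      Matrix.mul_neg]
    abel
  let φ' : (Fin n → Fin n → ℂ) →ₗ[ℝ] (Fin n → Fin n → ℂ) := φ.restrictScalars ℝ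
  let ad' : Matrix (Fin n) (Fin n) ℂ → (Fin n → Fin n → ℂ) →ₗ[ℝ] (Fin n → Fin n → ℂ) :=
    fun S => (φ ∘ₗ ad S).restrictScalars ℝ
  have hz := eq_zero_of_hasDerivWithinAt_linear (T := T) (ad' sys.S0) (fun k => ad' (sys.S k)) hu
    (z := fun t => φ' (y t)) (by
      intro t ht
      have h1 := ((LinearMap.toContinuousLinearMap φ').hasFDerivAt).comp_hasDerivWithinAt t
        (hy t ht).hasDerivWithinAt
      refine h1.congr_deriv (Eq.symm ?_)
      change φ (ad sys.S0 (φ (y t))) + ∑ k, u t k • φ (ad (sys.S k) (φ (y t))) =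
        φ (ad sys.S0 (y t) + ∑ k, (u t k : ℂ) • ad (sys.S k) (y t))
      rw [map_add, map_sum, ← hφad _ h0]
      congr 1
      refine Finset.sum_congr rfl fun k _ => ?_
      rw [← hφad _ (hk k), map_smul]
      rfl) (hφJ _ hx) T ⟨hT.le, le_rfl⟩
  have := hsub (y T)
  rwa [show φ (y T) = 0 from hz, sub_zero] at this

/-- Induction along the chain of controls that steers `1` to `U`. -/
theorem Controllable.conj_mem (hctrl : sys.Controllable)
    {J : Submodule ℂ (Matrix (Fin n) (Fin n) ℂ)}
    (h0 : ∀ x ∈ J, x * sys.S0 - sys.S0 * x ∈ J)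
    (hk : ∀ k, ∀ x ∈ J, x * sys.S k - sys.S k * x ∈ J) {U : Matrix (Fin n) (Fin n) ℂ}
    (hU : U ∈ unitaryGroup (Fin n) ℂ) {x : Matrix (Fin n) (Fin n) ℂ} (hx : x ∈ J) :
    U * x * Uᴴ ∈ J := by
  have h := hctrl 1 (one_mem _) U hU
  clear hU
  induction h with
  | refl => simpa using hx
  | tail _ hs ih => exact hs.conj_mem h0 hk ih

end QuantumSystem

/-! ### Conjugation by unitary matrices -/

/-- The permutation matrix of `σ`, acting on rows. -/
def rowPerm {n : ℕ} (σ : Equiv.Perm (Fin n)) : Matrix (Fin n) (Fin n) ℂ :=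
  (1 : Matrix (Fin n) (Fin n) ℂ).submatrix σ id

theorem rowPerm_conj {n : ℕ} (σ : Equiv.Perm (Fin n)) (d : Fin n → ℂ) :
    rowPerm σ * diagonal d * (rowPerm σ)ᴴ = diagonal (d ∘ σ) := by
  ext i j
  rw [Matrix.mul_apply, Finset.sum_eq_single (σ j)]
  · by_cases h : i = j
    · simp [rowPerm, Matrix.mul_diagonal, h, Matrix.one_apply]
    · simp [rowPerm, Matrix.mul_diagonal, h, Matrix.one_apply]
  · intro b _ hb
    simp [rowPerm, Matrix.one_apply, hb.symm]
  · simp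

theorem rowPerm_mem {n : ℕ} (σ : Equiv.Perm (Fin n)) : rowPerm σ ∈ unitaryGroup (Fin n) ℂ := by
  rw [mem_unitaryGroup_iff, star_eq_conjTranspose]
  have h := rowPerm_conj σ (fun _ => 1)
  rw [diagonal_one, Matrix.mul_one] at h
  exact h.trans diagonal_one

/-- Unitary diagonalization of a Hermitian matrix. -/
theorem Matrix.IsHermitian.exists_diagonal {n : ℕ} {H : Matrix (Fin n) (Fin n) ℂ}
    (hH : H.IsHermitian) : ∃ V ∈ unitaryGroup (Fin n) ℂ, ∃ d : Fin n → ℂ,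
      H = V * diagonal d * Vᴴ :=
  ⟨_, hH.eigenvectorUnitary.2, _, hH.spectral_theorem⟩

theorem conjTranspose_mul_self_of_mem_unitaryGroup {n : ℕ} {V : Matrix (Fin n) (Fin n) ℂ}
    (hV : V ∈ unitaryGroup (Fin n) ℂ) : Vᴴ * V = 1 := mem_unitaryGroup_iff'.mp hV

theorem mul_conjTranspose_self_of_mem_unitaryGroup {n : ℕ} {V : Matrix (Fin n) (Fin n) ℂ}
    (hV : V ∈ unitaryGroup (Fin n) ℂ) : V * Vᴴ = 1 := mem_unitaryGroup_iff.mp hV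

theorem conjTranspose_mem_unitaryGroup {n : ℕ} {V : Matrix (Fin n) (Fin n) ℂ}
    (hV : V ∈ unitaryGroup (Fin n) ℂ) : Vᴴ ∈ unitaryGroup (Fin n) ℂ :=
  Unitary.star_mem hV

/-- If a Hermitian matrix `P` is trace orthogonal to all the unitary conjugates of a Hermitian
matrix that is not scalar, then `P` is scalar. -/
theorem exists_eq_smul_one_of_trace_conj_eq_zero {n : ℕ} {H P : Matrix (Fin n) (Fin n) ℂ}
    (hH : H.IsHermitian) (hP : P.IsHermitian) (hH' : ∀ c : ℂ, H ≠ c • 1)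
    (h : ∀ U ∈ unitaryGroup (Fin n) ℂ, trace (U * H * Uᴴ * P) = 0) : ∃ c : ℂ, P = c • 1 := by
  obtain ⟨V, hV, d, rfl⟩ := hH.exists_diagonal
  obtain ⟨W, hW, p, rfl⟩ := hP.exists_diagonal
  have hV1 := conjTranspose_mul_self_of_mem_unitaryGroup hV
  have hW1 := conjTranspose_mul_self_of_mem_unitaryGroup hW
  have hscalar : ∀ (V : Matrix (Fin n) (Fin n) ℂ), V ∈ unitaryGroup (Fin n) ℂ → ∀ d : Fin n → ℂ,
      (∀ i j, d i = d j) → ∃ c : ℂ, V * diagonal d * Vᴴ = c • 1 := by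
    intro V hV d hd
    rcases isEmpty_or_nonempty (Fin n) with hn | ⟨⟨i⟩⟩
    · exact ⟨0, Subsingleton.elim _ _⟩
    · refine ⟨d i, ?_⟩
      have : diagonal d = d i • (1 : Matrix (Fin n) (Fin n) ℂ) := by
        rw [smul_one_eq_diagonal]
        congr 1
        ext j
        exact hd j i
      rw [this]
      simp [mul_conjTranspose_self_of_mem_unitaryGroup hV]
  obtain ⟨a, b, hab⟩ : ∃ a b, d a ≠ d b := by
    by_contra! hd
    obtain ⟨c, hc⟩ := hscalar V hV d hd
    exact hH' c hc
  -- The unitary `W σ V†` carries the eigenbasis of `H` to a permutation of that of `P`, so the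
  -- trace pairs the two spectra.
  have hσ : ∀ σ : Equiv.Perm (Fin n), ∑ i, d (σ i) * p i = 0 := by
    intro σ
    have h1 := h (W * rowPerm σ * Vᴴ)
      (mul_mem (mul_mem hW (rowPerm_mem σ)) (conjTranspose_mem_unitaryGroup hV))
    have h2 : W * rowPerm σ * Vᴴ * (V * diagonal d * Vᴴ) * (W * rowPerm σ * Vᴴ)ᴴ *
        (W * diagonal p * Wᴴ) = W * (diagonal (d ∘ σ) * diagonal p * Wᴴ) := by
      rw [← rowPerm_conj]
      simp only [Matrix.conjTranspose_mul, Matrix.conjTranspose_conjTranspose, Matrix.mul_assoc]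
      simp only [← Matrix.mul_assoc Vᴴ V, ← Matrix.mul_assoc Wᴴ W, hV1, hW1, Matrix.one_mul]
    rw [h2, trace_mul_comm, Matrix.mul_assoc, hW1, Matrix.mul_one, diagonal_mul_diagonal,
      trace_diagonal] at h1
    exact h1
  refine hscalar W hW p fun i j => ?_
  by_contra hp
  have hij : i ≠ j := fun h => hp (by rw [h])
  have hab' : a ≠ b := fun h => hab (by rw [h])
  obtain ⟨σ, hσi, hσj⟩ : ∃ σ : Equiv.Perm (Fin n), σ i = a ∧ σ j = b := by
    refine ⟨(Equiv.swap i a).trans (Equiv.swap (Equiv.swap i a j) b), ?_, ?_⟩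
    · have h1 : Equiv.swap i a j ≠ a := fun h => hij.symm (by
        simpa using congrArg (Equiv.swap i a) h)
      simp [Equiv.swap_apply_of_ne_of_ne h1.symm hab']
    · simp
  have h1 := hσ σ
  -- The two rearrangements differ only at `i` and `j`; their difference is `(d a - d b) (p i - p
  -- j)`.
  have h2 := hσ ((Equiv.swap i j).trans σ)
  rw [← Finset.add_sum_erase _ _ (Finset.mem_univ i), ← Finset.add_sum_erase _ _
    (Finset.mem_erase.mpr ⟨hij.symm, Finset.mem_univ j⟩)] at h1 h2
  have h3 : ∑ x ∈ (Finset.univ.erase i).erase j, d (((Equiv.swap i j).trans σ) x) * p x =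
      ∑ x ∈ (Finset.univ.erase i).erase j, d (σ x) * p x := by
    refine Finset.sum_congr rfl fun x hx => ?_
    simp only [Finset.mem_erase] at hx
    simp [Equiv.swap_apply_of_ne_of_ne hx.2.1 hx.1]
  rw [h3] at h2
  simp only [Equiv.trans_apply, Equiv.swap_apply_left, Equiv.swap_apply_right, hσi, hσj] at h1 h2
  have h4 : (d a - d b) * (p i - p j) = 0 := by linear_combination h1 - h2
  exact (mul_ne_zero (sub_ne_zero.mpr hab) (sub_ne_zero.mpr hp)) h4

/-- A controllable system on `U(n)`, `n ≥ 2`, has a control Hamiltonian that is not scalar. -/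
theorem QuantumSystem.Controllable.exists_not_scalar {n m : ℕ} {sys : QuantumSystem n m}
    (hctrl : sys.Controllable) (hn : 2 ≤ n) : ∃ k, ∀ c : ℂ, sys.H k ≠ c • 1 := by
  by_contra! hH
  choose c hc using hH
  obtain ⟨V, hV, d, hd⟩ := sys.H0_hermitian.exists_diagonal
  have hV1 := conjTranspose_mul_self_of_mem_unitaryGroup hV
  set i : Fin n := ⟨0, by omega⟩
  set j : Fin n := ⟨1, by omega⟩
  have hij : j ≠ i := by simp [i, j]
  -- The projector `w` on an eigenvector of `H0` commutes with the drift and with the scalar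
  -- controls, so its span would be invariant under all unitary conjugations; exchanging two
  -- eigenvectors refutes this.
  set e : Fin n → ℂ := Pi.single i 1 with he
  set w := V * diagonal e * Vᴴ with hw
  have hVV : ∀ p q : Matrix (Fin n) (Fin n) ℂ, V * p * Vᴴ * (V * q * Vᴴ) = V * (p * q) * Vᴴ := by
    intro p q
    simp only [Matrix.mul_assoc]
    simp only [← Matrix.mul_assoc Vᴴ V, hV1, Matrix.one_mul]
  have h1 := hctrl.conj_mem (J := Submodule.span ℂ {w}) (U := V * rowPerm (Equiv.swap i j) * Vᴴ)
    (x := w) (by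
      intro x hx
      obtain ⟨a, rfl⟩ := Submodule.mem_span_singleton.mp hx
      have : w * sys.H0 = sys.H0 * w := by
        rw [hd, hw, hVV, hVV, diagonal_mul_diagonal, diagonal_mul_diagonal]
        simp only [mul_comm]
      simp [S0, this, smul_comm a Complex.I])
    (by
      intro k x hx
      simp [S, hc])
    (mul_mem (mul_mem hV (rowPerm_mem _)) (conjTranspose_mem_unitaryGroup hV))
    (Submodule.mem_span_singleton_self w)
  obtain ⟨a, ha⟩ := Submodule.mem_span_singleton.mp h1
  have h2 : V * rowPerm (Equiv.swap i j) * Vᴴ * w * (V * rowPerm (Equiv.swap i j) * Vᴴ)ᴴ =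
      V * diagonal (e ∘ Equiv.swap i j) * Vᴴ := by
    rw [← rowPerm_conj, hw]
    simp only [Matrix.conjTranspose_mul, Matrix.conjTranspose_conjTranspose, Matrix.mul_assoc]
    simp only [← Matrix.mul_assoc Vᴴ V, hV1, Matrix.one_mul]
  rw [h2, hw] at ha
  have h3 := congrArg (fun A => Vᴴ * A * V) ha
  simp only [Matrix.mul_smul, Matrix.smul_mul, Matrix.mul_assoc, hV1, Matrix.mul_one] at h3
  simp only [← Matrix.mul_assoc, hV1, Matrix.one_mul] at h3
  have h4 := congrFun (congrFun h3 j) j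
  simp [he, hij] at h4

/-! ### Zero sets of polynomials -/

namespace MvPolynomial

/-- Induction with Fubini: wherever the leading coefficient in the first variable is nonzero, hence
almost everywhere, the fibre is the finite root set of a nonzero polynomial. -/
theorem volume_zeroLocus_fin_eq_zero : ∀ {N : ℕ} {p : MvPolynomial (Fin N) ℝ}, p ≠ 0 →
    volume {a : Fin N → ℝ | eval a p = 0} = 0
  | 0, p, hp => by
    have : {a : Fin 0 → ℝ | eval a p = 0} = ∅ := by
      refine Set.eq_empty_iff_forall_notMem.mpr fun a ha => hp ?_
      refine MvPolynomial.funext fun x => ?_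
      rw [map_zero, Subsingleton.elim x a]
      exact ha
    rw [this, measure_empty]
  | N + 1, p, hp => by
    have hf : finSuccEquiv ℝ N p ≠ 0 := by simpa using hp
    have ih := volume_zeroLocus_fin_eq_zero (Polynomial.leadingCoeff_ne_zero.mpr hf)
    have hmeas : MeasurableSet {a : Fin (N + 1) → ℝ | eval a p = 0} :=
      (isClosed_eq (MvPolynomial.continuous_eval p) continuous_const).measurableSet
    let e := MeasurableEquiv.piFinSuccAbove (fun _ : Fin (N + 1) => ℝ) 0
    have he : MeasurePreserving e.symm volume volume :=
      (volume_preserving_piFinSuccAbove (fun _ : Fin (N + 1) => ℝ) 0).symm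
    have hes := he.comp (Measure.measurePreserving_swap (μ := (volume : Measure (Fin N → ℝ)))
      (ν := (volume : Measure ℝ)))
    rw [← hes.measure_preimage hmeas.nullMeasurableSet,
      Measure.measure_prod_null (hes.measurable hmeas)]
    filter_upwards [measure_eq_zero_iff_ae_notMem.mp ih] with s hs
    have hq : Polynomial.map (eval s) (finSuccEquiv ℝ N p) ≠ 0 := by
      intro h
      have := congrArg (fun q => Polynomial.coeff q (finSuccEquiv ℝ N p).natDegree) h
      simp only [Polynomial.coeff_map, Polynomial.coeff_zero] at this
      exact hs this
    refine ((Polynomial.finite_setOfPred_isRoot hq).subset fun y hy => ?_).measure_zero _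
    have h1 : eval (Fin.cons y s) p = 0 := by
      have h2 : eval (Fin.insertNth 0 y s) p = 0 := hy
      rwa [Fin.insertNth_zero] at h2
    rwa [eval_eq_eval_mv_eval'] at h1

/-- The zero set of a nonzero real polynomial in finitely many variables is a null set. -/
theorem volume_zeroLocus_eq_zero {σ : Type*} [Fintype σ] {p : MvPolynomial σ ℝ} (hp : p ≠ 0) :
    volume {a : σ → ℝ | eval a p = 0} = 0 := by
  let e := Fintype.equivFin σ
  have hr : rename e p ≠ 0 := fun h => hp (rename_injective e e.injective (by simpa using h))
  have h := volume_zeroLocus_fin_eq_zero hr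
  have hmp := volume_measurePreserving_piCongrLeft (fun _ : Fin (Fintype.card σ) => ℝ) e
  rw [← hmp.measure_preimage ((isClosed_eq (MvPolynomial.continuous_eval _)
    continuous_const).measurableSet.nullMeasurableSet)] at h
  convert h using 2
  ext a
  simp only [Set.mem_ofPred_eq, Set.mem_preimage, eval_rename]
  have : (MeasurableEquiv.piCongrLeft (fun _ : Fin (Fintype.card σ) => ℝ) e a) ∘ e = a := by
    ext i
    exact MeasurableEquiv.piCongrLeft_apply_apply (β := fun _ => ℝ) e a i
  rw [this]

/-- A nonzero complex polynomial does not vanish at the real points where some nonzero real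
polynomial does not vanish. -/
theorem exists_real_of_complex {σ : Type*} {q : MvPolynomial σ ℂ} (hq : q ≠ 0) :
    ∃ Q : MvPolynomial σ ℝ, Q ≠ 0 ∧ ∀ a : σ → ℝ, eval a Q ≠ 0 →
      eval (fun i => (a i : ℂ)) q ≠ 0 := by
  -- The product of `q` with its conjugate has real coefficients and vanishes wherever `q` does.
  set q' := q * map (starRingEnd ℂ) q with hq'
  have hmap : map (starRingEnd ℂ) q' = q' := by
    rw [hq', map_mul, map_map, mul_comm]
    congr 1
    rw [show (starRingEnd ℂ).comp (starRingEnd ℂ) = RingHom.id ℂ from RingHom.ext fun x => by simp]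
    exact MvPolynomial.map_id q
  obtain ⟨Q, hQ⟩ : q' ∈ Set.range (map Complex.ofRealHom) := by
    rw [mem_range_map_iff_coeffs_subset]
    intro c hc
    obtain ⟨d, -, rfl⟩ := mem_coeffs_iff.mp hc
    have h1 := congrArg (coeff d) hmap
    rw [coeff_map] at h1
    obtain ⟨r, hr⟩ := Complex.conj_eq_iff_real.mp h1
    exact ⟨r, hr.symm⟩
  have hne : q' ≠ 0 := by
    refine mul_ne_zero hq fun h => hq ?_
    exact map_injective _ (starRingEnd ℂ).injective (by simpa using h)
  refine ⟨Q, fun h => hne (by rw [← hQ, h, map_zero]), fun a ha h => ha ?_⟩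
  have h1 : eval (fun i => (a i : ℂ)) q' = 0 := by rw [hq', map_mul, h, zero_mul]
  rw [← hQ, eval_map] at h1
  have h2 := eval₂_comp_left Complex.ofRealHom (RingHom.id ℝ) a Q
  rw [RingHom.comp_id] at h2
  have h3 : Complex.ofRealHom (eval a Q) = 0 := by
    rw [← h1]
    exact h2
  simpa using h3

end MvPolynomial

/-! ### The polynomial detecting exceptional jets -/

open MvPolynomial in
/-- For a controllable system, the jets at which the brackets `B_k^j` are trace orthogonal to some
Hermitian matrix that is not scalar satisfy a polynomial equation. -/
theorem QuantumSystem.Controllable.exists_diffPoly {n m : ℕ} {sys : QuantumSystem n m}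
    (hctrl : sys.Controllable) :
    ∃ (M₀ : ℕ) (Q : MvPolynomial (Fin m × Fin (M₀ + 1)) ℝ), Q ≠ 0 ∧
      ∀ a : Fin m × ℕ → ℝ, eval (fun p : Fin m × Fin (M₀ + 1) => a (p.1, (p.2 : ℕ))) Q ≠ 0 →
        ∀ P : Matrix (Fin n) (Fin n) ℂ, P.IsHermitian →
          (∀ k, ∀ j ≤ M₀, trace ((sys.controlBracket k j).map
            (eval fun p => (a p : ℂ)) * P) = 0) → ∃ c : ℂ, P = c • 1 := by
  obtain ⟨s, J, hs, hSJ, h0, hk, hJ⟩ := sys.exists_generic_subspace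
  set W := Submodule.span (MvPolynomial (Fin m × ℕ) ℂ)
        ((fun p : Fin m × ℕ => sys.controlBracket p.1 p.2) '' s) with hW
  -- A common denominator: the product of those of a finite generating set of `J`.
  obtain ⟨q, hq, hqJ⟩ : ∃ q : MvPolynomial (Fin m × ℕ) ℂ, q ≠ 0 ∧
      ∀ x ∈ J, q • x.map (algebraMap ℂ _) ∈ W := by
    obtain ⟨F, hF⟩ := IsNoetherian.noetherian J
    choose! g hg using hJ
    have hFJ : ∀ x ∈ F, x ∈ J := fun x hx => hF ▸ Submodule.subset_span hx
    refine ⟨∏ x ∈ F, g x, Finset.prod_ne_zero_iff.mpr fun x hx => (hg x (hFJ x hx)).1, ?_⟩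
    intro x hx
    rw [← hF] at hx
    induction hx using Submodule.span_induction with
    | mem x hx =>
      rw [← Finset.prod_erase_mul _ _ hx, mul_smul]
      exact W.smul_mem _ (hg x (hFJ x hx)).2
    | zero => simp [Matrix.map_zero]
    | add x y _ _ hx hy =>
      rw [Matrix.map_add _ (map_add _), smul_add]
      exact W.add_mem hx hy
    | smul c x _ hx =>
      have : (c • x).map (algebraMap ℂ (MvPolynomial (Fin m × ℕ) ℂ)) =
          algebraMap ℂ (MvPolynomial (Fin m × ℕ) ℂ) c • x.map (algebraMap ℂ _) := by
        ext1 i j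
        simp
      rw [this, smul_comm]
      exact W.smul_mem _ hx
  obtain ⟨N, hN⟩ : ∃ N, (∀ p ∈ s, p.2 ≤ N) ∧ ∀ p ∈ q.vars, p.2 ≤ N := by
    obtain ⟨N, hN⟩ := ((hs.union q.vars.finite_toSet).image Prod.snd).bddAbove
    exact ⟨N, fun p hp => hN ⟨p, Or.inl hp, rfl⟩, fun p hp => hN ⟨p, Or.inr hp, rfl⟩⟩
  let f : Fin m × Fin (N + 1) → Fin m × ℕ := fun p => (p.1, (p.2 : ℕ))
  have hf : Function.Injective f := fun p p' h => by
    simp only [f, Prod.mk.injEq] at h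
    exact Prod.ext h.1 (Fin.ext h.2)
  obtain ⟨q₁, rfl⟩ := exists_rename_eq_of_vars_subset_range q f hf fun p hp =>
    ⟨(p.1, ⟨p.2, Nat.lt_succ_of_le (hN.2 p hp)⟩), rfl⟩
  obtain ⟨Q, hQ, hQq⟩ := exists_real_of_complex (q := q₁) (fun h => hq (by rw [h, map_zero]))
  refine ⟨N, Q, hQ, fun a ha P hP htr => ?_⟩
  set α : Fin m × ℕ → ℂ := fun p => (a p : ℂ) with hα
  have hqa : eval α (rename f q₁) ≠ 0 := by
    rw [eval_rename]
    exact hQq _ ha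
  have hWP : ∀ w ∈ W, trace (w.map (eval α) * P) = 0 := by
    intro w hw
    induction hw using Submodule.span_induction with
    | mem x hx =>
      obtain ⟨p, hp, rfl⟩ := hx
      exact htr p.1 p.2 (hN.1 p hp)
    | zero => simp [Matrix.map_zero]
    | add x y _ _ hx hy => rw [Matrix.map_add _ (map_add _), Matrix.add_mul, trace_add, hx, hy,
        add_zero]
    | smul c x _ hx =>
      have : (c • x).map (eval α) = eval α c • x.map (eval α) := by
        ext1 i j
        simp
      rw [this, Matrix.smul_mul, trace_smul, hx, smul_zero]
  have hJP : ∀ x ∈ J, trace (x * P) = 0 := by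
    intro x hx
    have h1 := hWP _ (hqJ x hx)
    have : (rename f q₁ • x.map (algebraMap ℂ (MvPolynomial (Fin m × ℕ) ℂ))).map (eval α) =
        eval α (rename f q₁) • x := by
      ext1 i j
      simp [MvPolynomial.algebraMap_eq]
    rw [this, Matrix.smul_mul, trace_smul, smul_eq_mul] at h1
    exact (mul_eq_zero.mp h1).resolve_left hqa
  -- For `n ≤ 1` every matrix is scalar.
  rcases Nat.lt_or_ge n 2 with hn | hn
  · have : Subsingleton (Fin n) := Fin.subsingleton_iff_le_one.mpr (by omega)
    rcases isEmpty_or_nonempty (Fin n) with hn | ⟨⟨i⟩⟩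
    · exact ⟨0, Subsingleton.elim _ _⟩
    · refine ⟨P i i, ?_⟩
      ext j l
      simp [Subsingleton.elim j i, Subsingleton.elim l i]
  · obtain ⟨k, hk'⟩ := hctrl.exists_not_scalar hn
    refine exists_eq_smul_one_of_trace_conj_eq_zero (sys.H_hermitian k) hP hk' fun U hU => ?_
    have h1 := hJP _ (hctrl.conj_mem h0 hk hU (hSJ k))
    simpa [S] using h1

/-! ### Regularity of matrix valued functions -/

/-- Entrywise regularity of a matrix valued function. -/
def MatrixContDiffOn {a b : ℕ} (r : ℕ) (A : ℝ → Matrix (Fin a) (Fin b) ℂ) (s : Set ℝ) : Prop :=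
  ∀ i j, ContDiffOn ℝ r (fun t => A t i j) s

namespace MatrixContDiffOn

variable {a b c r : ℕ} {s : Set ℝ}

theorem const (A : Matrix (Fin a) (Fin b) ℂ) : MatrixContDiffOn r (fun _ => A) s :=
  fun _ _ => contDiffOn_const

theorem mul {A : ℝ → Matrix (Fin a) (Fin b) ℂ} {B : ℝ → Matrix (Fin b) (Fin c) ℂ}
    (hA : MatrixContDiffOn r A s) (hB : MatrixContDiffOn r B s) :
    MatrixContDiffOn r (fun t => A t * B t) s := by
  intro i j
  simp only [Matrix.mul_apply]
  exact ContDiffOn.sum fun k _ => (hA i k).mul (hB k j)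

theorem conjTranspose {A : ℝ → Matrix (Fin a) (Fin b) ℂ} (hA : MatrixContDiffOn r A s) :
    MatrixContDiffOn r (fun t => (A t)ᴴ) s :=
  fun i j => Complex.conjCLE.contDiff.comp_contDiffOn (hA j i)

theorem re_trace {A : ℝ → Matrix (Fin a) (Fin a) ℂ} (hA : MatrixContDiffOn r A s) :
    ContDiffOn ℝ r (fun t => (trace (A t)).re) s := by
  refine Complex.reCLM.contDiff.comp_contDiffOn ?_
  simp only [trace, diag_apply]
  exact ContDiffOn.sum fun k _ => hA k k

end MatrixContDiffOn

namespace QuantumSystem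

variable {n m : ℕ} {sys : QuantumSystem n m}

theorem matrixContDiffOn_generator {r : ℕ} {s : Set ℝ} {u : ℝ → Fin m → ℝ}
    (hu : ∀ k, ContDiffOn ℝ r (fun t => u t k) s) :
    MatrixContDiffOn r (fun t => sys.generator (u t)) s := by
  intro i j
  simp only [generator, Matrix.add_apply, Matrix.sum_apply, Matrix.smul_apply, smul_eq_mul]
  exact contDiffOn_const.add (ContDiffOn.sum fun k _ =>
    (Complex.ofRealCLM.contDiff.comp_contDiffOn (hu k)).mul contDiffOn_const)

theorem IsSolution.matrixContDiffOn_zero {T : ℝ} {u : ℝ → Fin m → ℝ}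
    {X : ℝ → Matrix (Fin n) (Fin n) ℂ} (hX : sys.IsSolution T u X) :
    MatrixContDiffOn 0 X (Icc 0 T) := fun i j => by
  rw [Nat.cast_zero, contDiffOn_zero]
  exact fun t ht => (hX t ht i j).continuousWithinAt

theorem IsSolution.matrixContDiffOn_succ {T : ℝ} (hT : 0 < T) {u : ℝ → Fin m → ℝ}
    {X : ℝ → Matrix (Fin n) (Fin n) ℂ} (hX : sys.IsSolution T u X) {r : ℕ}
    (hu : ∀ k, ContDiffOn ℝ r (fun t => u t k) (Icc 0 T)) (h : MatrixContDiffOn r X (Icc 0 T)) :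
    MatrixContDiffOn (r + 1) X (Icc 0 T) := by
  intro i j
  have hU := uniqueDiffOn_Icc hT
  rw [Nat.cast_add, Nat.cast_one, contDiffOn_succ_iff_derivWithin hU]
  refine ⟨fun t ht => (hX t ht i j).differentiableWithinAt, by simp, ?_⟩
  refine ((matrixContDiffOn_generator (sys := sys) hu).mul h i j).congr fun t ht => ?_
  exact (hX t ht i j).derivWithin (hU t ht)

theorem IsSolution.mem_unitaryGroup {T : ℝ} {u : ℝ → Fin m → ℝ}
    {X : ℝ → Matrix (Fin n) (Fin n) ℂ} (hX : sys.IsSolution T u X) (h0 : X 0 = 1) {t : ℝ}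
    (ht : t ∈ Icc 0 T) : X t ∈ unitaryGroup (Fin n) ℂ := by
  rw [mem_unitaryGroup_iff', star_eq_conjTranspose]
  have := matrix_eq_of_hasMatrixDerivWithinAt_zero (A := fun t => (X t)ᴴ * X t) (T := T) (by
    intro t ht
    convert (hX.hasMatrixDerivWithinAt_conjTranspose ht).mul (hX.hasMatrixDerivWithinAt ht) using 1
    simp [Matrix.mul_assoc]) t ht
  simpa [h0] using this

end QuantumSystem

namespace RIGA

variable {n nbar m : ℕ} {sys : QuantumSystem n m} {E : Matrix (Fin n) (Fin nbar) ℂ} {K Tf : ℝ}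
  {N : ℕ}

/-- The inputs of an execution are as regular as the seed. -/
theorem contDiffOn_input (r : RIGA sys E K Tf N) (hTf : 0 < Tf) {M : ℕ}
    (hseed : ∀ k, ContDiffOn ℝ M (fun t => r.u 0 t k) (Icc 0 Tf)) :
    ∀ ℓ ≤ N, (∀ k, ContDiffOn ℝ M (fun t => r.u ℓ t k) (Icc 0 Tf)) ∧
      MatrixContDiffOn M (r.X ℓ) (Icc 0 Tf) := by
  intro ℓ
  induction ℓ with
  | zero =>
    intro _
    refine ⟨hseed, ?_⟩
    have hX := r.solution 0 (Nat.zero_le _)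
    have : ∀ q ≤ M, MatrixContDiffOn q (r.X 0) (Icc 0 Tf) := by
      intro q
      induction q with
      | zero => exact fun _ => hX.matrixContDiffOn_zero
      | succ q ih =>
        exact fun hq => hX.matrixContDiffOn_succ hTf
          (fun k => (hseed k).of_le (by exact_mod_cast (Nat.le_of_succ_le hq))) (ih (by omega))
    exact this M le_rfl
  | succ ℓ ih =>
    intro hℓ
    obtain ⟨hu, hXℓ⟩ := ih (by omega)
    have hX := r.solution (ℓ + 1) hℓ
    -- Bootstrap: the feedback makes the input as regular as the state, and the differential
    -- equation then gives the state one more derivative.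
    have hinput : ∀ q ≤ M, MatrixContDiffOn q (r.X (ℓ + 1)) (Icc 0 Tf) →
        ∀ k, ContDiffOn ℝ q (fun t => r.u (ℓ + 1) t k) (Icc 0 Tf) := by
      intro q hq h k
      have hqM : (q : WithTop ℕ∞) ≤ M := by exact_mod_cast hq
      have hXq : MatrixContDiffOn q (r.X ℓ) (Icc 0 Tf) := fun i j => (hXℓ i j).of_le hqM
      have href := hXq.mul (MatrixContDiffOn.const ((r.X ℓ Tf)ᴴ * r.goal (ℓ + 1)))
      have hfb := (((MatrixContDiffOn.const Eᴴ).mul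
        (((href.conjTranspose.mul (.const (sys.S k))).mul href).mul
          (href.conjTranspose.mul h))).mul (.const E)).re_trace
      refine (((hu k).of_le hqM).add (contDiffOn_const (c := 2 * K) |>.mul hfb)).congr
        fun t ht => ?_
      rw [r.closed_loop ℓ (by omega) t ht k, feedback_eq]
    have : ∀ q ≤ M, MatrixContDiffOn q (r.X (ℓ + 1)) (Icc 0 Tf) := by
      intro q
      induction q with
      | zero => exact fun _ => hX.matrixContDiffOn_zero
      | succ q ih =>
        exact fun hq => hX.matrixContDiffOn_succ hTf
          (hinput q (by omega) (ih (by omega))) (ih (by omega))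
    exact ⟨hinput M le_rfl (this M le_rfl), this M le_rfl⟩

end RIGA

/-! ### The brackets along the jets of an input -/

/-- The jet at time `t` of the input `u` on `[0, T]`. -/
def inputJet {m : ℕ} (T : ℝ) (u : ℝ → Fin m → ℝ) (t : ℝ) : Fin m × ℕ → ℝ :=
  fun p => iteratedDerivWithin p.2 (fun s => u s p.1) (Icc 0 T) t

namespace QuantumSystem

open MvPolynomial

variable {n m : ℕ} {sys : QuantumSystem n m}

theorem jetShift_mem_supported {j : ℕ} {p : MvPolynomial (Fin m × ℕ) ℂ}
    (hp : p ∈ supported ℂ {v : Fin m × ℕ | v.2 < j}) :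
    jetShift m p ∈ supported ℂ {v : Fin m × ℕ | v.2 < j + 1} := by
  have hle : supported ℂ {v : Fin m × ℕ | v.2 < j} ≤ supported ℂ {v : Fin m × ℕ | v.2 < j + 1} :=
    supported_mono fun v (hv : v.2 < j) => Nat.lt_succ_of_lt hv
  refine Algebra.adjoin_induction (R := ℂ) (s := X '' {v : Fin m × ℕ | v.2 < j})
    (p := fun p _ => jetShift m p ∈ supported ℂ {v : Fin m × ℕ | v.2 < j + 1})
    ?_ ?_ ?_ ?_ hp
  · rintro _ ⟨v, hv, rfl⟩
    rw [jetShift, mkDerivation_X]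
    exact Algebra.subset_adjoin ⟨_, Nat.succ_lt_succ hv, rfl⟩
  · intro c
    rw [Derivation.map_algebraMap]
    exact zero_mem _
  · intro x y _ _ hx hy
    rw [map_add]
    exact add_mem hx hy
  · intro x y hx' hy' hx hy
    rw [Derivation.leibniz, smul_eq_mul, smul_eq_mul]
    exact add_mem (mul_mem (hle hx') hy) (mul_mem (hle hy') hx)

theorem jetGenerator_mem_supported (j : ℕ) (a b : Fin n) :
    sys.jetGenerator a b ∈ supported ℂ {v : Fin m × ℕ | v.2 < j + 1} := by
  simp only [jetGenerator, Matrix.add_apply, Matrix.sum_apply, Matrix.smul_apply, Matrix.map_apply]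
  refine add_mem (Subalgebra.algebraMap_mem _ _) (sum_mem fun k _ => ?_)
  exact mul_mem (Algebra.subset_adjoin ⟨_, Nat.succ_pos j, rfl⟩) (Subalgebra.algebraMap_mem _ _)

/-- `B_k^j` involves only jets of order below `j`, so for `j < M` it can be differentiated along an
input of class `C^M`. -/
theorem controlBracket_mem_supported (k : Fin m) (j : ℕ) (a b : Fin n) :
    sys.controlBracket k j a b ∈ supported ℂ {v : Fin m × ℕ | v.2 < j} := by
  induction j generalizing a b with
  | zero => exact Subalgebra.algebraMap_mem _ _
  | succ j ih =>
    have hle : supported ℂ {v : Fin m × ℕ | v.2 < j} ≤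
        supported ℂ {v : Fin m × ℕ | v.2 < j + 1} :=
      supported_mono fun v (hv : v.2 < j) => Nat.lt_succ_of_lt hv
    rw [controlBracket, jetBracket_apply]
    simp only [Matrix.add_apply, Matrix.sub_apply, Matrix.mul_apply, Derivation.matrixMap_apply]
    exact add_mem (jetShift_mem_supported (ih a b)) (sub_mem
      (sum_mem fun c _ => mul_mem (hle (ih a c)) (jetGenerator_mem_supported j c b))
      (sum_mem fun c _ => mul_mem (jetGenerator_mem_supported j a c) (hle (ih c b))))

/-- The chain rule, checked on variables. The bound `v.2 < M` is strict because the derivative of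
order `v.2` must still be differentiable. -/
theorem hasDerivWithinAt_eval_inputJet {T : ℝ} (hT : 0 < T) {u : ℝ → Fin m → ℝ} {M : ℕ}
    (hu : ∀ k, ContDiffOn ℝ M (fun t => u t k) (Icc 0 T)) {p : MvPolynomial (Fin m × ℕ) ℂ}
    (hp : p ∈ supported ℂ {v : Fin m × ℕ | v.2 < M}) {t : ℝ} (ht : t ∈ Icc 0 T) :
    HasDerivWithinAt (fun s => eval (fun v => (inputJet T u s v : ℂ)) p)
      (eval (fun v => (inputJet T u t v : ℂ)) (jetShift m p)) (Icc 0 T) t := by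
  have hU := uniqueDiffOn_Icc hT
  refine Algebra.adjoin_induction (R := ℂ) (s := X '' {v : Fin m × ℕ | v.2 < M})
    (p := fun p _ => HasDerivWithinAt (fun s => eval (fun v => (inputJet T u s v : ℂ)) p)
      (eval (fun v => (inputJet T u t v : ℂ)) (jetShift m p)) (Icc 0 T) t) ?_ ?_ ?_ ?_ hp
  · rintro _ ⟨v, hv, rfl⟩
    simp only [jetShift, mkDerivation_X, eval_X]
    have hd := ((hu v.1).differentiableOn_iteratedDerivWithin (m := v.2)
      (by exact_mod_cast hv) hU t ht).hasDerivWithinAt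
    have h1 : inputJet T u t (v.1, v.2 + 1) = derivWithin
        (iteratedDerivWithin v.2 (fun s => u s v.1) (Icc 0 T)) (Icc 0 T) t := by
      rw [inputJet, iteratedDerivWithin_succ]
    rw [h1]
    exact hd.ofReal_comp
  · intro c
    rw [Derivation.map_algebraMap, map_zero, MvPolynomial.algebraMap_eq]
    simp only [eval_C]
    exact hasDerivWithinAt_const t (Icc 0 T) c
  · intro x y _ _ hx hy
    simp only [map_add]
    exact hx.add hy
  · intro x y _ _ hx hy
    simp only [Derivation.leibniz, map_add, map_mul, smul_eq_mul]
    exact (hx.mul hy).congr_deriv (by ring)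

theorem eval_jetGenerator (T : ℝ) (u : ℝ → Fin m → ℝ) (t : ℝ) :
    sys.jetGenerator.map (eval fun v => (inputJet T u t v : ℂ)) = sys.generator (u t) := by
  ext1 i j
  simp [jetGenerator, generator, inputJet, Matrix.sum_apply, MvPolynomial.algebraMap_eq]

/-- If the control directions, transported along a trajectory, are trace orthogonal to a fixed
matrix at all times, then so are all the brackets along the jets of the input. -/
theorem IsSolution.trace_controlBracket_eq_zero {T : ℝ} (hT : 0 < T) {u : ℝ → Fin m → ℝ} {M : ℕ}
    (hu : ∀ k, ContDiffOn ℝ M (fun t => u t k) (Icc 0 T))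
    {X : ℝ → Matrix (Fin n) (Fin n) ℂ} (hX : sys.IsSolution T u X)
    {P : Matrix (Fin n) (Fin n) ℂ} {k : Fin m}
    (hP : ∀ t ∈ Icc 0 T, trace ((X t)ᴴ * sys.S k * X t * P) = 0) :
    ∀ j ≤ M, ∀ t ∈ Icc 0 T, trace ((X t)ᴴ * (sys.controlBracket k j).map
      (eval fun v => (inputJet T u t v : ℂ)) * X t * P) = 0 := by
  intro j
  induction j with
  | zero =>
    intro _ t ht
    rw [← hP t ht]
    congr 4
    ext1 a b
    simp [controlBracket, MvPolynomial.algebraMap_eq]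
  | succ j ih =>
    intro hj t ht
    have hle : supported ℂ {v : Fin m × ℕ | v.2 < j} ≤ supported ℂ {v : Fin m × ℕ | v.2 < M} :=
      supported_mono fun v (hv : v.2 < j) => (hv.trans (Nat.lt_of_succ_le hj) : v.2 < M)
    have hB : HasMatrixDerivWithinAt (fun s => (sys.controlBracket k j).map
        (eval fun v => (inputJet T u s v : ℂ))) (((jetShift m).matrixMap n
          (sys.controlBracket k j)).map (eval fun v => (inputJet T u t v : ℂ))) (Icc 0 T) t :=
      fun a b => hasDerivWithinAt_eval_inputJet hT hu
        (hle (controlBracket_mem_supported k j a b)) ht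
    -- Since `X†' = -X† G`, the derivative of `X† B X` is `X† (B' + B G - G B) X`, the next bracket.
    have hd := ((((hX.hasMatrixDerivWithinAt_conjTranspose ht).mul hB).mul
      (hX.hasMatrixDerivWithinAt ht)).mul_const P).trace
    have h0 : HasDerivWithinAt (fun _ : ℝ => (0 : ℂ)) 0 (Icc 0 T) t :=
      hasDerivWithinAt_const _ _ _
    have h1 := (uniqueDiffOn_Icc hT t ht).eq_deriv _ hd
      (h0.congr_of_mem (fun s hs => ih (by omega) s hs) ht)
    rw [← h1]
    congr 2
    rw [controlBracket, jetBracket_apply, ← eval_jetGenerator T u t,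
      Matrix.map_add _ (map_add _), Matrix.map_sub _ (map_sub _), Matrix.map_mul, Matrix.map_mul]
    simp only [Matrix.mul_add, Matrix.mul_sub, Matrix.add_mul, Matrix.sub_mul, Matrix.neg_mul,
      Matrix.mul_assoc]
    abel

end QuantumSystem

/-! ### The partial trace Lyapunov function -/

theorem pdist_nonneg {n nbar : ℕ} (E : Matrix (Fin n) (Fin nbar) ℂ)
    (X Y : Matrix (Fin n) (Fin n) ℂ) : 0 ≤ pdist E X Y := by
  let := Matrix.frobeniusNormedAddCommGroup (m := Fin n) (n := Fin nbar) (α := ℂ)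
  exact norm_nonneg ((X - Y) * E)

/-- Expansion of the Frobenius norm; the two quadratic terms are identities. It makes the two
conclusions of the theorem equivalent and turns `pdist < 2` into `𝒱 < 4`. -/
theorem pdist_sq {n nbar : ℕ} {E : Matrix (Fin n) (Fin nbar) ℂ} (hE : Eᴴ * E = 1)
    {X Y : Matrix (Fin n) (Fin n) ℂ} (hX : X ∈ unitaryGroup (Fin n) ℂ)
    (hY : Y ∈ unitaryGroup (Fin n) ℂ) : pdist E X Y ^ 2 = lyapunov E (Yᴴ * X) := by
  have h1 : pdist E X Y ^ 2 = (trace (((X - Y) * E)ᴴ * ((X - Y) * E))).re := by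
    rw [pdist, frobenius_norm_def, ← Real.rpow_natCast, ← Real.rpow_mul (by positivity)]
    simp only [trace, diag_apply, Matrix.mul_apply (M := ((X - Y) * E)ᴴ), conjTranspose_apply,
      Complex.re_sum]
    rw [Finset.sum_comm]
    norm_num
    refine Finset.sum_congr rfl fun i _ => Finset.sum_congr rfl fun j _ => ?_
    rw [← Complex.normSq_eq_norm_sq, Complex.normSq_apply]
  have h2 : ((X - Y) * E)ᴴ * ((X - Y) * E) =
      (1 + 1) - (Eᴴ * (Yᴴ * X) * E) - (Eᴴ * (Yᴴ * X) * E)ᴴ := by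
    have hX1 : Xᴴ * (X * E) = E := by
      rw [← Matrix.mul_assoc, conjTranspose_mul_self_of_mem_unitaryGroup hX, Matrix.one_mul]
    have hY1 : Yᴴ * (Y * E) = E := by
      rw [← Matrix.mul_assoc, conjTranspose_mul_self_of_mem_unitaryGroup hY, Matrix.one_mul]
    simp only [Matrix.conjTranspose_mul, Matrix.conjTranspose_sub,
      Matrix.conjTranspose_conjTranspose, Matrix.mul_sub, Matrix.sub_mul, Matrix.mul_assoc, hX1, hY1, hE]
    abel
  rw [h1, h2, lyapunov, trace_sub, trace_sub, trace_conjTranspose, trace_add, trace_one]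
  simp
  ring

/-- The trace of an idempotent matrix is a natural number. -/
theorem exists_nat_trace_eq_of_isIdempotentElem {N : ℕ} {A : Matrix (Fin N) (Fin N) ℂ}
    (hA : A * A = A) : ∃ k : ℕ, trace A = k := by
  have h : IsIdempotentElem (toLin' A) := by
    rw [IsIdempotentElem, Module.End.mul_eq_comp, ← toLin'_mul, hA]
  have h2 := (LinearMap.IsIdempotentElem.isProj_range _ h).trace
  rw [Matrix.trace_toLin'_eq] at h2
  exact ⟨_, h2⟩

open scoped ComplexOrder in
/-- A critical value of the Lyapunov function below `4` is zero. -/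
theorem lyapunov_eq_zero_of_critical {n nbar : ℕ} (hn : nbar < n)
    {E : Matrix (Fin n) (Fin nbar) ℂ} (hE : Eᴴ * E = 1) {Z : Matrix (Fin n) (Fin n) ℂ}
    (hZ : Z ∈ unitaryGroup (Fin n) ℂ) {c : ℂ} (hc : E * Eᴴ * Z - (E * Eᴴ * Z)ᴴ = c • 1)
    (hV : lyapunov E Z < 4) : lyapunov E Z = 0 := by
  obtain ⟨v, hv, hv0⟩ : ∃ v, Eᴴ *ᵥ v = 0 ∧ v ≠ 0 := by
    have := LinearMap.ker_ne_bot_of_finrank_lt (f := Eᴴ.mulVecLin) (by simpa using hn)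
    obtain ⟨v, hv, hv0⟩ := Submodule.exists_mem_ne_zero_of_ne_bot this
    exact ⟨v, by simpa using hv, hv0⟩
  -- The quadratic form of the left side of `hc` vanishes at `v`, because `E† v = 0`.
  have hc0 : c = 0 := by
    have h1 := congrArg (fun A => star v ⬝ᵥ (A *ᵥ v)) hc
    have h2 : star v ᵥ* E = 0 := by
      have := congrArg star hv
      rwa [star_mulVec, conjTranspose_conjTranspose, star_zero] at this
    have h3 : star v ⬝ᵥ ((E * Eᴴ * Z) *ᵥ v) = 0 := by
      rw [Matrix.mul_assoc, ← mulVec_mulVec, dotProduct_mulVec, h2, zero_dotProduct]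
    have h4 : (E * Eᴴ * Z)ᴴ *ᵥ v = 0 := by
      simp only [conjTranspose_mul, conjTranspose_conjTranspose, ← mulVec_mulVec, hv, mulVec_zero]
    simp only [sub_mulVec, h4, sub_zero, h3, smul_mulVec, one_mulVec, dotProduct_smul,
      smul_eq_mul] at h1
    refine (mul_eq_zero.mp h1.symm).resolve_right ?_
    exact fun h => hv0 (dotProduct_star_self_eq_zero.mp h)
  rw [hc0, zero_smul, sub_eq_zero] at hc
  set M := Eᴴ * Z * E with hM
  have hZE : Zᴴ * E = E * M := by
    have := congrArg (· * E) hc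
    simp only [conjTranspose_mul, conjTranspose_conjTranspose, Matrix.mul_assoc, hE,
      Matrix.mul_one] at this
    rw [← this, hM, Matrix.mul_assoc]
  have hMH : Mᴴ = M := by
    rw [hM]
    simp only [conjTranspose_mul, conjTranspose_conjTranspose]
    rw [hZE, ← Matrix.mul_assoc, hE, Matrix.one_mul]
  have hMM : M * M = 1 := by
    have h1 : (Zᴴ * E)ᴴ * (Zᴴ * E) = 1 := by
      rw [conjTranspose_mul, conjTranspose_conjTranspose, Matrix.mul_assoc,
        ← Matrix.mul_assoc Z, mul_conjTranspose_self_of_mem_unitaryGroup hZ, Matrix.one_mul, hE]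
    rwa [hZE, conjTranspose_mul, Matrix.mul_assoc, ← Matrix.mul_assoc Eᴴ, hE, Matrix.one_mul,
      hMH] at h1
  -- `M` is a Hermitian involution, so this is the projector on its eigenvalue `-1`; with `k` its
  -- rank, `𝒱 = 4 k`.
  obtain ⟨k, hk⟩ := exists_nat_trace_eq_of_isIdempotentElem (A := (1 / 2 : ℂ) • (1 - M)) (by
    rw [Matrix.smul_mul, Matrix.mul_smul, Matrix.sub_mul, Matrix.one_mul, Matrix.mul_sub,
      Matrix.mul_one, hMM, smul_smul]
    module)
  have hV' : lyapunov E Z = 4 * k := by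
    have h1 := congrArg Complex.re hk
    rw [trace_smul, trace_sub, trace_one] at h1
    simp only [Fintype.card_fin, smul_eq_mul, Complex.natCast_re, Complex.mul_re,
      Complex.sub_re] at h1
    norm_num at h1
    rw [lyapunov, ← hM]
    linarith
  rw [hV'] at hV ⊢
  have hk1 : (k : ℝ) < 1 := by linarith
  have : k = 0 := by
    have : k < 1 := by exact_mod_cast hk1
    omega
  simp [this]

/-! ### One step of the algorithm -/

namespace QuantumSystem

variable {n nbar m : ℕ} {sys : QuantumSystem n m}

theorem feedback_eq_of_mem_unitaryGroup (E : Matrix (Fin n) (Fin nbar) ℂ) (K : ℝ)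
    (S X : Matrix (Fin n) (Fin n) ℂ) {Xbar : Matrix (Fin n) (Fin n) ℂ}
    (h : Xbar ∈ unitaryGroup (Fin n) ℂ) :
    feedback E K S Xbar X = 2 * K * (trace (Eᴴ * (Xbarᴴ * S * X) * E)).re := by
  rw [feedback_eq]
  congr 5
  rw [Matrix.mul_assoc (Xbarᴴ * S), ← Matrix.mul_assoc Xbar,
    mul_conjTranspose_self_of_mem_unitaryGroup h, Matrix.one_mul]

theorem generator_sub (v w : Fin m → ℝ) :
    sys.generator v - sys.generator w = ∑ k, ((v k - w k : ℝ) : ℂ) • sys.S k := by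
  simp [generator, sub_smul, Finset.sum_sub_distrib]

/-- The dynamics of the tracking error. -/
theorem IsSolution.hasMatrixDerivWithinAt_error {T : ℝ} {u u' : ℝ → Fin m → ℝ}
    {X X' : ℝ → Matrix (Fin n) (Fin n) ℂ} (hX : sys.IsSolution T u X)
    (hX' : sys.IsSolution T u' X') (R : Matrix (Fin n) (Fin n) ℂ) {t : ℝ} (ht : t ∈ Icc 0 T) :
    HasMatrixDerivWithinAt (fun s => (X s * R)ᴴ * X' s)
      (∑ k, ((u' t k - u t k : ℝ) : ℂ) • ((X t * R)ᴴ * sys.S k * X' t)) (Icc 0 T) t := by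
  have h := ((hX.hasMatrixDerivWithinAt ht).mul_const R).conjTranspose.mul
    (hX'.hasMatrixDerivWithinAt ht)
  convert h using 1
  have h2 : (X t * R)ᴴ * (sys.generator (u' t) - sys.generator (u t)) * X' t =
      (sys.generator (u t) * X t * R)ᴴ * X' t + (X t * R)ᴴ * (sys.generator (u' t) * X' t) := by
    simp only [conjTranspose_mul, conjTranspose_generator, Matrix.mul_assoc, Matrix.mul_sub,
      Matrix.sub_mul, Matrix.neg_mul, Matrix.mul_neg]
    abel
  rw [← h2, generator_sub]
  simp [Matrix.mul_sum, Matrix.sum_mul]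

theorem hasDerivWithinAt_lyapunov (E : Matrix (Fin n) (Fin nbar) ℂ)
    {Z : ℝ → Matrix (Fin n) (Fin n) ℂ} {Z' : Matrix (Fin n) (Fin n) ℂ} {s : Set ℝ} {t : ℝ}
    (h : HasMatrixDerivWithinAt Z Z' s t) :
    HasDerivWithinAt (fun r => lyapunov E (Z r)) (-(2 * (trace (Eᴴ * Z' * E)).re)) s t :=
  ((Complex.reCLM.hasFDerivAt.comp_hasDerivWithinAt t
    ((h.const_mul Eᴴ).mul_const E).trace).const_mul 2).const_sub (2 * (nbar : ℝ))

/-- Along the closed loop, the derivative of the Lyapunov function is minus the sum of the squares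
of the feedback controls divided by the gain. -/
theorem IsSolution.hasDerivWithinAt_lyapunov_error {E : Matrix (Fin n) (Fin nbar) ℂ} {K T : ℝ}
    (hK : 0 < K) {u u' : ℝ → Fin m → ℝ} {X X' : ℝ → Matrix (Fin n) (Fin n) ℂ}
    (hX : sys.IsSolution T u X) (hX' : sys.IsSolution T u' X') (h0 : X 0 = 1)
    {R : Matrix (Fin n) (Fin n) ℂ} (hR : R ∈ unitaryGroup (Fin n) ℂ) {t : ℝ} (ht : t ∈ Icc 0 T)
    (hcl : ∀ k, u' t k = u t k + feedback E K (sys.S k) (X t * R) (X' t)) :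
    HasDerivWithinAt (fun s => lyapunov E ((X s * R)ᴴ * X' s))
      (-(∑ k, (u' t k - u t k) ^ 2) / K) (Icc 0 T) t := by
  refine (hasDerivWithinAt_lyapunov E
    (hX.hasMatrixDerivWithinAt_error hX' R ht)).congr_deriv ?_
  simp only [Matrix.mul_sum, Matrix.sum_mul, trace_sum, Complex.re_sum, Matrix.mul_smul,
    Matrix.smul_mul, trace_smul, smul_eq_mul, Complex.re_ofReal_mul]
  rw [neg_div, Finset.mul_sum, Finset.sum_div]
  congr 1
  refine Finset.sum_congr rfl fun k _ => ?_
  have h1 := feedback_eq_of_mem_unitaryGroup E K (sys.S k) (X' t)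
    (mul_mem (hX.mem_unitaryGroup h0 ht) hR)
  have h2 : u' t k - u t k = 2 * K *
      (trace (Eᴴ * ((X t * R)ᴴ * sys.S k * X' t) * E)).re := by
    rw [hcl k, h1]
    ring
  rw [sq, eq_div_iff hK.ne']
  nth_rewrite 3 [h2]
  ring

/-- If the Lyapunov function does not decrease over a step, then the closed loop input coincides
with the reference input, and the initial tracking error is trace orthogonal to the transported
control directions. -/
theorem IsSolution.trace_eq_zero_of_lyapunov_le {E : Matrix (Fin n) (Fin nbar) ℂ} {K T : ℝ}
    (hK : 0 < K) (hT : 0 < T) {u u' : ℝ → Fin m → ℝ} {X X' : ℝ → Matrix (Fin n) (Fin n) ℂ}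
    (hX : sys.IsSolution T u X) (hX' : sys.IsSolution T u' X') (h0 : X 0 = 1) (h0' : X' 0 = 1)
    {R : Matrix (Fin n) (Fin n) ℂ} (hR : R ∈ unitaryGroup (Fin n) ℂ)
    (hcl : ∀ t ∈ Icc 0 T, ∀ k, u' t k = u t k + feedback E K (sys.S k) (X t * R) (X' t))
    (hanti : AntitoneOn (fun s => lyapunov E ((X s * R)ᴴ * X' s)) (Icc 0 T))
    (hle : lyapunov E ((X 0 * R)ᴴ * X' 0) ≤ lyapunov E ((X T * R)ᴴ * X' T)) :
    ∀ t ∈ Icc 0 T, ∀ k, trace ((X t)ᴴ * sys.S k * X t *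
      (E * Eᴴ * Rᴴ - (E * Eᴴ * Rᴴ)ᴴ)) = 0 := by
  have h0T : (0 : ℝ) ∈ Icc 0 T := ⟨le_rfl, hT.le⟩
  have hTT : T ∈ Icc 0 T := ⟨hT.le, le_rfl⟩
  have hconst : ∀ t ∈ Icc 0 T, lyapunov E ((X t * R)ᴴ * X' t) = lyapunov E ((X 0 * R)ᴴ * X' 0) :=
    fun t ht => le_antisymm (hanti h0T ht ht.1) (hle.trans (hanti ht hTT ht.2))
  have huu : ∀ t ∈ Icc 0 T, ∀ k, u' t k = u t k := by
    intro t ht k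
    have hd := hX.hasDerivWithinAt_lyapunov_error hK hX' h0 hR ht (hcl t ht)
    have h1 := (uniqueDiffOn_Icc hT t ht).eq_deriv _ hd
      ((hasDerivWithinAt_const t (Icc 0 T) _).congr_of_mem hconst ht)
    rw [div_eq_zero_iff, or_iff_left hK.ne', neg_eq_zero,
      Finset.sum_eq_zero_iff_of_nonneg fun _ _ => sq_nonneg _] at h1
    exact sub_eq_zero.mp (pow_eq_zero_iff two_ne_zero |>.mp (h1 k (Finset.mem_univ k)))
  have hZ : ∀ t ∈ Icc 0 T, (X t * R)ᴴ * X' t = Rᴴ := by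
    intro t ht
    have := matrix_eq_of_hasMatrixDerivWithinAt_zero (A := fun t => (X t * R)ᴴ * X' t) (T := T)
      (fun t ht => by
        convert hX.hasMatrixDerivWithinAt_error hX' R ht using 1
        simp [huu t ht]) t ht
    simpa [h0, h0'] using this
  intro t ht k
  have hU := mul_mem (hX.mem_unitaryGroup h0 ht) hR
  have hXX : X' t = X t := by
    have h1 := congrArg (fun A => X t * R * A) (hZ t ht)
    simp only [← Matrix.mul_assoc, mul_conjTranspose_self_of_mem_unitaryGroup hU,
      Matrix.one_mul] at h1
    rw [h1, Matrix.mul_assoc, mul_conjTranspose_self_of_mem_unitaryGroup hR, Matrix.mul_one]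
  have h1 := hcl t ht k
  rw [huu t ht k, feedback_eq_of_mem_unitaryGroup E K (sys.S k) (X' t) hU, hXX] at h1
  have h2 : (trace (Eᴴ * ((X t * R)ᴴ * sys.S k * X t) * E)).re = 0 := by
    have h3 : 2 * K * (trace (Eᴴ * ((X t * R)ᴴ * sys.S k * X t) * E)).re = 0 := by linarith
    exact (mul_eq_zero.mp h3).resolve_left (by positivity)
  set A := (X t)ᴴ * sys.S k * X t with hA
  set P := E * Eᴴ * Rᴴ with hP
  have h3 : trace (Eᴴ * ((X t * R)ᴴ * sys.S k * X t) * E) = trace (A * P) := by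
    rw [trace_mul_comm, trace_mul_comm A, hA, hP]
    simp only [conjTranspose_mul, Matrix.mul_assoc]
  have hAH : Aᴴ = -A := by
    simp [hA, conjTranspose_S, Matrix.mul_assoc]
  -- As `A` is skew-Hermitian, `trace (A (P - P†)) = 2 Re trace (A P)`, which the vanishing feedback
  -- makes zero.
  have h4 : trace (A * Pᴴ) = -star (trace (A * P)) := by
    rw [← trace_conjTranspose, conjTranspose_mul A, hAH, Matrix.mul_neg, trace_neg, neg_neg,
      trace_mul_comm]
  rw [Matrix.mul_sub, trace_sub, h4]
  rw [h3] at h2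
  apply Complex.ext <;> simp [h2]

end QuantumSystem

/-- The ratio `V₁ / V₀` serves unless `V₀ = 0` or `V₁ = 0`; the value `1 / 2` keeps the factor
positive in these cases. -/
theorem exists_contraction_factor {V₀ V₁ : ℝ} (h₁ : 0 ≤ V₁) (hle : V₁ ≤ V₀)
    (hlt : 0 < V₀ → V₁ < V₀) : ∃ lam : ℝ, 0 < lam ∧ lam < 1 ∧ V₁ ≤ lam * V₀ := by
  rcases (h₁.trans hle).eq_or_lt with h | h
  · exact ⟨1 / 2, by norm_num, by norm_num, by linarith⟩
  · refine ⟨max (V₁ / V₀) (1 / 2), lt_max_of_lt_right (by norm_num), max_lt ?_ (by norm_num), ?_⟩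
    · rw [div_lt_one h]
      exact hlt h
    · rw [← div_le_iff₀ h]
      exact le_max_left _ _

end

/-! ### The contraction estimate -/

theorem mainTheorem9 (n m : ℕ) (sys : QuantumSystem n m) (hctrl : sys.Controllable) :
    ∃ (M₀ : ℕ) (Q : MvPolynomial (Fin m × Fin (M₀ + 1)) ℝ),
      Q ≠ 0 ∧
      volume {a : Fin m × Fin (M₀ + 1) → ℝ | MvPolynomial.eval a Q = 0} = 0 ∧
      ∀ (nbar : ℕ) (_ : nbar < n) (E : Matrix (Fin n) (Fin nbar) ℂ) (_ : Eᴴ * E = 1)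
        (K Tf : ℝ) (_ : 0 < K) (_ : 0 < Tf) (N : ℕ) (r : RIGA sys E K Tf N)
        (_ : ∀ k, ContDiffOn ℝ M₀ (fun t => r.u 0 t k) (Icc 0 Tf))
        (ℓ : ℕ) (_ : 1 ≤ ℓ) (_ : ℓ < N),
        (¬ ∀ t ∈ Icc 0 Tf, evalDiffPoly Q Tf (r.u ℓ) t = 0) →
        pdist E (r.X ℓ Tf) (r.goal ℓ) < 2 →
        (r.goal (ℓ + 1) - r.goal ℓ) * E = 0 →
        ∃ lam : ℝ, 0 < lam ∧ lam < 1 ∧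
          pdist E (r.X (ℓ + 1) Tf) (r.goal (ℓ + 1)) ≤ √lam * pdist E (r.X ℓ Tf) (r.goal ℓ) ∧
          lyapunov E (r.error (ℓ + 1) Tf) ≤ lam * lyapunov E (r.error ℓ Tf) := by
  obtain ⟨M₀, Q, hQ, hmain⟩ := hctrl.exists_diffPoly
  refine ⟨M₀, Q, hQ, MvPolynomial.volume_zeroLocus_eq_zero hQ, ?_⟩
  intro nbar hn E hE K Tf hK hTf N r hseed ℓ hℓ hℓN hjet hdist hgoal
  have h0T : (0 : ℝ) ∈ Icc 0 Tf := ⟨le_rfl, hTf.le⟩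
  have hTT : Tf ∈ Icc 0 Tf := ⟨hTf.le, le_rfl⟩
  have hX := r.solution ℓ (by omega)
  have hX' := r.solution (ℓ + 1) (by omega)
  have h0 := r.initial ℓ (by omega)
  have h0' := r.initial (ℓ + 1) (by omega)
  have hg := r.goal_unitary ℓ hℓ (by omega)
  have hg' := r.goal_unitary (ℓ + 1) (by omega) (by omega)
  have hXT := hX.mem_unitaryGroup h0 hTT
  have hX'T := hX'.mem_unitaryGroup h0' hTT
  set R := (r.X ℓ Tf)ᴴ * r.goal (ℓ + 1) with hRdef
  have hR : R ∈ unitaryGroup (Fin n) ℂ := mul_mem (conjTranspose_mem_unitaryGroup hXT) hg'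
  have hcl : ∀ t ∈ Icc 0 Tf, ∀ k, r.u (ℓ + 1) t k = r.u ℓ t k +
      feedback E K (sys.S k) (r.X ℓ t * R) (r.X (ℓ + 1) t) := r.closed_loop ℓ hℓN
  have herr : ∀ ℓ < N, r.error (ℓ + 1) Tf = (r.goal (ℓ + 1))ᴴ * r.X (ℓ + 1) Tf := by
    intro ℓ hℓ
    have := mul_conjTranspose_self_of_mem_unitaryGroup
      ((r.solution ℓ hℓ.le).mem_unitaryGroup (r.initial ℓ hℓ.le) hTT)
    rw [RIGA.error, RIGA.reference, Nat.add_sub_cancel, ← Matrix.mul_assoc, this, Matrix.one_mul]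
  have hV1 : lyapunov E ((r.X ℓ Tf * R)ᴴ * r.X (ℓ + 1) Tf) =
      lyapunov E (r.error (ℓ + 1) Tf) := rfl
  -- The initial error is `R† = goal_{ℓ+1}† X^ℓ(Tf)`, and by (c) `𝒱` does not see the change of
  -- goal.
  have hV0 : lyapunov E ((r.X ℓ 0 * R)ᴴ * r.X (ℓ + 1) 0) = lyapunov E (r.error ℓ Tf) := by
    obtain ⟨j, rfl⟩ : ∃ j, ℓ = j + 1 := ⟨ℓ - 1, by omega⟩
    rw [herr j (by omega), h0, h0', hRdef, Matrix.one_mul, Matrix.mul_one, conjTranspose_mul,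
      conjTranspose_conjTranspose, lyapunov, lyapunov, ← Matrix.mul_assoc, ← Matrix.mul_assoc,
      ← conjTranspose_mul, ← conjTranspose_mul]
    rw [Matrix.sub_mul, sub_eq_zero] at hgoal
    rw [hgoal]
  have hp1 : pdist E (r.X (ℓ + 1) Tf) (r.goal (ℓ + 1)) ^ 2 = lyapunov E (r.error (ℓ + 1) Tf) := by
    rw [pdist_sq hE hX'T hg', herr ℓ hℓN]
  have hp0 : pdist E (r.X ℓ Tf) (r.goal ℓ) ^ 2 = lyapunov E (r.error ℓ Tf) := by
    obtain ⟨j, rfl⟩ : ∃ j, ℓ = j + 1 := ⟨ℓ - 1, by omega⟩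
    rw [pdist_sq hE hXT hg, herr j (by omega)]
  have hanti : AntitoneOn (fun s => lyapunov E ((r.X ℓ s * R)ᴴ * r.X (ℓ + 1) s)) (Icc 0 Tf) := by
    have hd := fun t ht => hX.hasDerivWithinAt_lyapunov_error hK hX' h0 hR ht (hcl t ht)
    refine antitoneOn_of_hasDerivWithinAt_nonpos (convex_Icc 0 Tf)
      (fun t ht => (hd t ht).continuousWithinAt)
      (fun t ht => (hd t (interior_subset ht)).mono interior_subset) fun t _ => ?_
    exact div_nonpos_of_nonpos_of_nonneg
      (neg_nonpos.mpr (Finset.sum_nonneg fun _ _ => sq_nonneg _)) hK.le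
  have hstep := hanti h0T hTT hTf.le
  simp only [hV0, hV1] at hstep
  have hnonneg : 0 ≤ lyapunov E (r.error (ℓ + 1) Tf) := hp1 ▸ sq_nonneg _
  have hstrict : 0 < lyapunov E (r.error ℓ Tf) →
      lyapunov E (r.error (ℓ + 1) Tf) < lyapunov E (r.error ℓ Tf) := by
    intro hpos
    by_contra! hle
    rw [← hV0, ← hV1] at hle
    have htr := hX.trace_eq_zero_of_lyapunov_le hK hTf hX' h0 h0' hR hcl hanti hle
    have hu := (r.contDiffOn_input hTf hseed ℓ hℓN.le).1
    push Not at hjet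
    obtain ⟨t, ht, hQt⟩ := hjet
    set P := E * Eᴴ * Rᴴ with hP
    have hXt := hX.mem_unitaryGroup h0 ht
    have hXt1 := conjTranspose_mul_self_of_mem_unitaryGroup hXt
    -- The factor `I` makes `P - P†` Hermitian; conjugation by `X` moves the transport from the
    -- brackets to this matrix.
    obtain ⟨c, hc⟩ := hmain (inputJet Tf (r.u ℓ) t) hQt
      (r.X ℓ t * (Complex.I • (P - Pᴴ)) * (r.X ℓ t)ᴴ) (by
        refine isHermitian_mul_mul_conjTranspose _ ?_
        simp [IsHermitian, conjTranspose_smul, smul_sub, neg_add_eq_sub]) (by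
        intro k j hj
        have := hX.trace_controlBracket_eq_zero hTf hu (fun t ht => htr t ht k) j hj t ht
        rw [← Matrix.mul_assoc, ← Matrix.mul_assoc, trace_mul_comm, Matrix.mul_smul,
          Matrix.mul_smul, trace_smul, ← Matrix.mul_assoc, ← Matrix.mul_assoc, this, smul_zero])
    have hc' : P - Pᴴ = (-Complex.I * c) • (1 : Matrix (Fin n) (Fin n) ℂ) := by
      have h1 := congrArg (fun A => (-Complex.I) • ((r.X ℓ t)ᴴ * A * r.X ℓ t)) hc
      simp only [Matrix.mul_assoc, hXt1, Matrix.mul_one, Matrix.mul_smul, Matrix.smul_mul,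
        smul_smul] at h1
      simp only [← Matrix.mul_assoc, hXt1, Matrix.one_mul] at h1
      simpa using h1
    have hRV : lyapunov E Rᴴ = lyapunov E (r.error ℓ Tf) := by
      rw [← hV0, h0, h0', Matrix.one_mul, Matrix.mul_one]
    have h4 : lyapunov E Rᴴ < 4 := by
      rw [hRV, ← hp0]
      have := pdist_nonneg E (r.X ℓ Tf) (r.goal ℓ)
      nlinarith
    have := lyapunov_eq_zero_of_critical hn hE (conjTranspose_mem_unitaryGroup hR) hc' h4
    rw [hRV] at this
    exact hpos.ne' this
  obtain ⟨lam, hlam0, hlam1, hlam⟩ := exists_contraction_factor hnonneg hstep hstrict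
  refine ⟨lam, hlam0, hlam1, ?_, hlam⟩
  refine le_of_sq_le_sq ?_ (mul_nonneg (Real.sqrt_nonneg _) (pdist_nonneg _ _ _))
  rw [mul_pow, Real.sq_sqrt hlam0.le, hp1, hp0]
  exact hlam
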